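/- **Model.** The input is a simple graph $G$ with vertex set $[1..n]$ and $m\ge 1$ edges, each edge $e$ having a real weight $w(e)>0$. There are $m$ stations with IDs $1,\dots,m$; each edge is held by exactly one station and each station holds exactly one edge. A station initially knows $n$, its ID, its edge and the weight of its edge, but not $m$. The stations communicate in synchronous steps over a multiple-access channel with collision detection: in each step all stations hear silence if no station transmits, the transmitted message if exactly one station transmits, and a collision noise (distinct from silence) if at least two stations transmit. A randomized algorithm proceeds by queries. Each query is determined by $n$ and the feedback heard in the preceding steps; it specifies which stations are to attempt a transmission in the step (in terms of their IDs, edges and weights) and a probability. Each specified station transmits with this probability, independently over stations and steps; its message is a dummy message, its weight, its edge, or its edge with the weight. Whether the algorithm halts, and what it then outputs, is likewise determined by $n$ and the feedback heard. The time of an execution is the number of steps performed until the algorithm halts. A spanning forest of $G$ is a maximal cycle-free set $T$ of edges of $G$, and $|T|$ is its number of edges. An algorithm finds a minimum-weight spanning forest if in every possible execution its output is a spanning forest of $G$ of the smallest total weight, all of whose edges have been heard on the channel during the execution. **Theorem.** There is a randomized algorithm such that, for all $n$ and all $m\ge 1$ and every weighted graph with $n$ vertices and $m$ edges distributed among $m$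 stations as above, the algorithm finds a minimum-weight spanning forest $T$ in expected time $\mathcal{O}(|T|+W\log m)$, where $W$ is the number of distinct weights on the edges of $T$, and in worst-case time $\mathcal{O}(m)$. The constants hidden in the $\mathcal{O}$ notation are absolute. -/

import Mathlib

open scoped ENNReal NNReal

/-! ## Minimum-weight spanning forests -/

/-- `F` is the edge set of a (maximal) spanning forest of `G`: a cycle-free set of edges of `G`
to which no further edge of `G` can be added without creating a cycle. -/
def IsSpanningForest {n : ℕ} (G : SimpleGraph (Fin n)) (F : Finset (Sym2 (Fin n))) : Prop :=
  (∀ e ∈ F, e ∈ G.edgeSet) ∧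
  (SimpleGraph.fromEdgeSet (F : Set (Sym2 (Fin n)))).IsAcyclic ∧
  ∀ e ∈ G.edgeSet, e ∉ F →
    ¬ (SimpleGraph.fromEdgeSet (insert e (F : Set (Sym2 (Fin n))))).IsAcyclic

/-- A spanning forest whose total weight is smallest among all spanning forests of `G`. -/
def IsMinWeightSpanningForest {n : ℕ} (G : SimpleGraph (Fin n)) (w : Sym2 (Fin n) → ℝ)
    (F : Finset (Sym2 (Fin n))) : Prop :=
  IsSpanningForest G F ∧
  ∀ F' : Finset (Sym2 (Fin n)), IsSpanningForest G F' → ∑ e ∈ F, w e ≤ ∑ e ∈ F', w e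

/-- The number of distinct weights on the edges of `F`. -/
noncomputable def numWeights {n : ℕ} (w : Sym2 (Fin n) → ℝ) (F : Finset (Sym2 (Fin n))) : ℕ :=
  (F.image w).card

namespace Channel

/-! ## The multiple-access channel with collision detection -/

/-- What a transmitting station puts into its message: nothing (a dummy message), the weight of
its edge, its edge, or its edge together with the weight. -/
inductive Content
  | dummy
  | weight
  | edge
  | edgeAndWeight

/-- Messages, for input graphs with `n` vertices. -/
inductive Message (n : ℕ)
  | dummy
  | weight (x : ℝ)
  | edge (e : Sym2 (Fin n))
  | edgeAndWeight (e : Sym2 (Fin n)) (x : ℝ)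

/-- The message with content of kind `c` of a station that holds the edge `e` of weight `x`. -/
def Content.message {n : ℕ} (c : Content) (e : Sym2 (Fin n)) (x : ℝ) : Message n :=
  match c with
  | .dummy => .dummy
  | .weight => .weight x
  | .edge => .edge e
  | .edgeAndWeight => .edgeAndWeight e x

/-- The message reveals the edge `e`. -/
def Message.Reveals {n : ℕ} (msg : Message n) (e : Sym2 (Fin n)) : Prop :=
  match msg with
  | .dummy => False
  | .weight _ => False
  | .edge e' => e' = e
  | .edgeAndWeight e' _ => e' = e

/-- What all the stations hear on the channel in one step: background noise (no station
transmitted), collision noise (at least two stations transmitted), or the message of the only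
station that transmitted. -/
inductive Feedback (n : ℕ)
  | silence
  | collision
  | heard (msg : Message n)

/-- The feedback of the steps performed so far, in chronological order. -/
abbrev History (n : ℕ) := List (Feedback n)

/-- The edge `e` has been heard on the channel. -/
def History.Reveals {n : ℕ} (h : History n) (e : Sym2 (Fin n)) : Prop :=
  ∃ msg : Message n, Feedback.heard msg ∈ h ∧ msg.Reveals e

/-- One query of a randomized algorithm. `specified p e x` says that the station with ID `p`, if
it holds the edge `e` of weight `x`, is specified by the query; each specified station performs
a random experiment with probability of success `prob`, the same for all the stations, and
transmits a message with the given kind of content if the experiment succeeds. -/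
structure Query (n : ℕ) where
  specified : ℕ → Sym2 (Fin n) → ℝ → Prop
  prob : ℝ≥0
  prob_le_one : prob ≤ 1
  content : Content

/-- A randomized adaptive algorithm. The next query is determined by the number `n` of vertices
and by the feedback heard so far (in particular the number of edges is not known);
`query n h = none` means that the algorithm halts. `output n h` is the set of edges it returns
when it halts after having heard `h`. -/
structure Algorithm where
  query : (n : ℕ) → History n → Option (Query n)
  output : (n : ℕ) → History n → Finset (Sym2 (Fin n))

/-- A weighted graph distributed among stations: a simple graph on `n` vertices with positive
weights on its edges, and `m` stations that hold its edges, each edge being held by exactly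
one station and each station holding exactly one edge.
The weights of pairs that are not edges play no role. -/
structure Input (n m : ℕ) where
  graph : SimpleGraph (Fin n)
  weight : Sym2 (Fin n) → ℝ
  weight_pos : ∀ e ∈ graph.edgeSet, 0 < weight e
  holds : Fin m ≃ graph.edgeSet

/-- The edge held by the station `i`. -/
def Input.edge {n m : ℕ} (inp : Input n m) (i : Fin m) : Sym2 (Fin n) :=
  (inp.holds i : Sym2 (Fin n))

open Classical in
/-- The stations specified by a query. The IDs of the `m` stations are `1, …, m`, so the station
with index `i : Fin m` has the ID `i + 1`. -/
noncomputable def Input.specified {n m : ℕ} (inp : Input n m) (q : Query n) : Finset (Fin m) :=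
  Finset.univ.filter fun i => q.specified ((i : ℕ) + 1) (inp.edge i) (inp.weight (inp.edge i))

/-- The random subset of `S` that contains each element of `S` with probability `p`,
independently of the other elements. -/
noncomputable def randomSubset {m : ℕ} (S : Finset (Fin m)) (p : ℝ≥0) (hp : p ≤ 1) :
    PMF (Finset (Fin m)) :=
  PMF.ofFinset
    (fun A => if A ⊆ S then ((p ^ A.card * (1 - p) ^ (S.card - A.card) : ℝ≥0) : ℝ≥0∞) else 0)
    S.powerset
    (by
      rw [Finset.sum_congr rfl fun A hA => if_pos (Finset.mem_powerset.mp hA),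
        ← ENNReal.ofNNReal_finsetSum, Finset.sum_pow_mul_eq_add_pow, add_tsub_cancel_of_le hp]
      simp)
    (fun A hA => if_neg fun h => hA (Finset.mem_powerset.mpr h))

/-- What is heard when exactly the stations in `A` transmit. -/
noncomputable def Input.feedback {n m : ℕ} (inp : Input n m) (c : Content)
    (A : Finset (Fin m)) : Feedback n :=
  match A.toList with
  | [] => .silence
  | [i] => .heard (c.message (inp.edge i) (inp.weight (inp.edge i)))
  | _ => .collision

/-! ## Executions and their running time -/

/-- The algorithm performs another step after having heard `h`. -/
def Algorithm.Running (alg : Algorithm) {n : ℕ} (h : History n) : Prop :=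
  alg.query n h ≠ none

/-- One step of the execution after the history `h`. The random experiments are independent of
everything before; if the algorithm has halted then the history does not change any more. -/
noncomputable def Algorithm.step (alg : Algorithm) {n m : ℕ} (inp : Input n m)
    (h : History n) : PMF (History n) :=
  match alg.query n h with
  | none => PMF.pure h
  | some q =>
      (randomSubset (inp.specified q) q.prob q.prob_le_one).map
        fun A => h ++ [inp.feedback q.content A]

/-- The distribution of the history after `t` time units; it consists of the feedback of the
first `t` steps, or of all the steps if the algorithm halted earlier. -/
noncomputable def Algorithm.historyAt (alg : Algorithm) {n m : ℕ} (inp : Input n m) :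
    ℕ → PMF (History n)
  | 0 => PMF.pure []
  | t + 1 => (alg.historyAt inp t).bind (alg.step inp)

/-- The expected number of steps that are performed: the sum over `t` of the probability that
the step number `t + 1` is performed. -/
noncomputable def Algorithm.expectedTime (alg : Algorithm) {n m : ℕ} (inp : Input n m) : ℝ≥0∞ :=
  ∑' t : ℕ, (alg.historyAt inp t).toOuterMeasure {h | alg.Running h}

/-- In every possible execution at most `N` steps are performed. -/
def Algorithm.HaltsWithin (alg : Algorithm) {n m : ℕ} (inp : Input n m) (N : ℕ) : Prop :=
  ∀ h ∈ (alg.historyAt inp N).support, ¬ alg.Running h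

/-- In every possible execution, when the algorithm halts, its output is a minimum-weight
spanning forest all edges of which have been heard on the channel. -/
def Algorithm.FindsMinWeightSpanningForest (alg : Algorithm) {n m : ℕ} (inp : Input n m) : Prop :=
  ∀ t : ℕ, ∀ h ∈ (alg.historyAt inp t).support, ¬ alg.Running h →
    IsMinWeightSpanningForest inp.graph inp.weight (alg.output n h) ∧
    ∀ e ∈ alg.output n h, h.Reveals e

end Channel

/-! Two procedures alternate on the channel. A deterministic scan asks the IDs one by one; silence
at ID m + 1 shows that all edges are known, which gives the worst-case bound O(m). A randomized
search follows Kruskal's algorithm: to find the least weight of an edge between different trees it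
hears a random candidate and keeps only the lighter ones, then it collects edges of that weight
until none joins two trees. A phase ends only on silence at transmission probability 1, which proves
that no station takes part, so randomness affects the time but never the output.

The expected time comes from a potential (`expectedTime_le_of_drift`). The probability 2⁻ᵏ is
adapted step by step: k rises on a collision and falls on silence. By `guess_drift`, a term
measuring the misfit of k makes each such step gain at least one in expectation, provided that a
success is worth 1536. In a collecting phase a success adds a forest edge, which happens at most |T|
times. In a searching phase it shortens the bit length of the number of candidates by 1/2 on average
(`two_mul_sum_size_add_card_le`), so one weight costs O(log m).

Phases are charged to the weights of T, since every Kruskal forest uses only weights of T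
(`IsGreedyForest.image_subset`). This follows from the rank inequality `card_le_card_of_edgeJoined`,
applied at each weight threshold. -/

section Forests

/-! ### Cycle-free edge sets as independent sets over `ZMod 2` -/

variable {V : Type*}

/-- The endpoints of `e` are connected by edges in `F`. -/
def EdgeJoined (F : Set (Sym2 V)) (e : Sym2 V) : Prop :=
  ∀ u ∈ e, ∀ v ∈ e, (SimpleGraph.fromEdgeSet F).Reachable u v

theorem edgeJoined_mk {F : Set (Sym2 V)} {u v : V} :
    EdgeJoined F s(u, v) ↔ (SimpleGraph.fromEdgeSet F).Reachable u v := by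
  constructor
  · intro h
    exact h u (by simp) v (by simp)
  · intro h a ha b hb
    rw [Sym2.mem_iff] at ha hb
    rcases ha with rfl | rfl <;> rcases hb with rfl | rfl
    exacts [.rfl, h, h.symm, .rfl]

theorem EdgeJoined.mono {F F' : Set (Sym2 V)} (h : F ⊆ F') {e : Sym2 V} (he : EdgeJoined F e) :
    EdgeJoined F' e :=
  fun u hu v hv => (he u hu v hv).mono (SimpleGraph.fromEdgeSet_mono h)

theorem edgeJoined_of_mem {F : Set (Sym2 V)} {e : Sym2 V} (he : e ∈ F) : EdgeJoined F e := by
  induction e with | _ u v => ?_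
  rw [edgeJoined_mk]
  by_cases huv : u = v
  · subst huv; rfl
  · exact SimpleGraph.Adj.reachable (by simp [he, huv])

theorem acyclic_insert_iff {F : Set (Sym2 V)} {e : Sym2 V} (hd : ¬ e.IsDiag) (he : e ∉ F) :
    (SimpleGraph.fromEdgeSet (insert e F)).IsAcyclic ↔
      (SimpleGraph.fromEdgeSet F).IsAcyclic ∧ ¬ EdgeJoined F e := by
  induction e with | _ u v => ?_
  have huv : u ≠ v := by simpa using hd
  have : SimpleGraph.fromEdgeSet (insert s(u, v) F) =
      SimpleGraph.fromEdgeSet F ⊔ SimpleGraph.edge u v := by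
    rw [SimpleGraph.edge, ← SimpleGraph.fromEdgeSet_union, Set.union_singleton]
  rw [this, SimpleGraph.isAcyclic_sup_fromEdgeSet_iff, edgeJoined_mk]
  simp [huv, he]

theorem add_self_zmod_two (x : V → ZMod 2) : x + x = 0 :=
  funext fun _ => CharTwo.add_self_eq_zero _

variable [DecidableEq V]

/-- The incidence vector of an edge. -/
def incVec : Sym2 V → V → ZMod 2 :=
  Sym2.lift ⟨fun u v => Pi.single u 1 + Pi.single v 1, fun _ _ => add_comm _ _⟩

theorem incVec_mk (u v : V) : incVec s(u, v) = Pi.single u 1 + Pi.single v 1 := rfl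

/-- Summing incidence vectors along a walk cancels the interior vertices in characteristic 2. -/
theorem incVec_mem_span {F : Set (Sym2 V)} {e : Sym2 V} (h : EdgeJoined F e) :
    incVec e ∈ Submodule.span (ZMod 2) (incVec '' F) := by
  induction e with | _ u v => ?_
  rw [edgeJoined_mk] at h
  obtain ⟨p⟩ := h
  induction p with
  | nil => rw [incVec_mk, add_self_zmod_two]; exact Submodule.zero_mem _
  | @cons a b c hab p ih =>
    have h1 : incVec s(a, b) ∈ Submodule.span (ZMod 2) (incVec '' F) :=
      Submodule.subset_span ⟨_, by simpa using (SimpleGraph.fromEdgeSet_adj F).mp hab |>.1, rfl⟩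
    have h2 := Submodule.add_mem _ h1 ih
    convert h2 using 1
    simp only [incVec_mk]
    have := add_self_zmod_two (Pi.single b 1 : V → ZMod 2)
    linear_combination -this

variable [Fintype V]

/-- Summing coordinates over the component of `u` is a linear functional that kills every edge of
`F`, but takes the value 1 on an edge leaving the component. -/
theorem edgeJoined_of_incVec_mem_span {F : Set (Sym2 V)} {e : Sym2 V}
    (h : incVec e ∈ Submodule.span (ZMod 2) (incVec '' F)) : EdgeJoined F e := by
  classical
  induction e with | _ u v => ?_
  rw [edgeJoined_mk]
  by_contra hn
  let S : Finset V := Finset.univ.filter fun a => (SimpleGraph.fromEdgeSet F).Reachable u a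
  let φ : (V → ZMod 2) →ₗ[ZMod 2] ZMod 2 := ∑ i ∈ S, LinearMap.proj i
  have hφ : ∀ a b : V, φ (incVec s(a, b)) =
      (if a ∈ S then 1 else 0) + (if b ∈ S then 1 else 0) := by
    intro a b
    simp [φ, incVec_mk, LinearMap.sum_apply, Finset.sum_add_distrib, Pi.single_apply]
  have hle : Submodule.span (ZMod 2) (incVec '' F) ≤ LinearMap.ker φ := by
    rw [Submodule.span_le]
    rintro _ ⟨f, hf, rfl⟩
    induction f with | _ a b => ?_
    have hab := edgeJoined_mk.mp (edgeJoined_of_mem hf)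
    have : a ∈ S ↔ b ∈ S := by
      simp only [S, Finset.mem_filter, Finset.mem_univ, true_and]
      exact ⟨fun h => h.trans hab, fun h => h.trans hab.symm⟩
    simp only [SetLike.mem_coe, LinearMap.mem_ker, hφ, this]
    exact CharTwo.add_self_eq_zero _
  have := hle h
  rw [LinearMap.mem_ker, hφ] at this
  simp [S, hn] at this

theorem linearIndepOn_incVec (F : Finset (Sym2 V)) (hd : ∀ e ∈ F, ¬ e.IsDiag)
    (h : (SimpleGraph.fromEdgeSet (F : Set (Sym2 V))).IsAcyclic) :
    LinearIndepOn (ZMod 2) incVec (F : Set (Sym2 V)) := by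
  induction F using Finset.induction_on with
  | empty => simp
  | insert e F he ih =>
    rw [Finset.coe_insert] at h ⊢
    rw [acyclic_insert_iff (hd e (by simp)) (by simpa using he)] at h
    rw [linearIndepOn_insert (by simpa using he)]
    exact ⟨ih (fun f hf => hd f (by simp [hf])) h.1, fun h' => h.2 (edgeJoined_of_incVec_mem_span h')⟩

/-- The incidence vectors of `F'` are independent and lie in the span of those of `F`, so dimensions
compare. -/
theorem card_le_card_of_edgeJoined {F F' : Finset (Sym2 V)} (hd : ∀ e ∈ F', ¬ e.IsDiag)
    (h : (SimpleGraph.fromEdgeSet (F' : Set (Sym2 V))).IsAcyclic)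
    (hj : ∀ e ∈ F', EdgeJoined (F : Set (Sym2 V)) e) : F'.card ≤ F.card := by
  have h1 := linearIndepOn_incVec F' hd h
  have h2 : Submodule.span (ZMod 2) (incVec '' (F' : Set (Sym2 V))) ≤
      Submodule.span (ZMod 2) (incVec '' (F : Set (Sym2 V))) := by
    rw [Submodule.span_le]
    rintro _ ⟨e, he, rfl⟩
    exact incVec_mem_span (hj e he)
  have h3 := Submodule.finrank_mono h2
  have h4 : Module.finrank (ZMod 2) (Submodule.span (ZMod 2) (incVec '' (F' : Set (Sym2 V))))
      = F'.card := by
    rw [Set.image_eq_range, finrank_span_eq_card h1]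
    simp
  have h5 : Module.finrank (ZMod 2) (Submodule.span (ZMod 2) (incVec '' (F : Set (Sym2 V))))
      ≤ F.card := by
    rw [← Finset.coe_image]
    exact (finrank_span_finset_le_card _).trans Finset.card_image_le
  omega

end Forests

/-! ### Kruskal's algorithm and comparison of forest weights -/

/-- If the counting function of the weights of `F` dominates that of `F'`, then `F` is lighter,
and if it is not strictly lighter then the same weights occur. -/
theorem sum_le_sum_of_count_le {α β : Type*} (w : α → ℝ) (w' : β → ℝ) (F : Finset α) (F' : Finset β)
    (hc : F.card = F'.card)
    (h : ∀ t : ℝ, (F'.filter fun e => w' e ≤ t).card ≤ (F.filter fun e => w e ≤ t).card) :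
    ∑ e ∈ F, w e ≤ ∑ e ∈ F', w' e ∧
      (∑ e ∈ F', w' e ≤ ∑ e ∈ F, w e → F.image w = F'.image w') := by
  classical
  induction hk : F.card generalizing F F' with
  | zero =>
    have h1 : F = ∅ := Finset.card_eq_zero.mp hk
    have h2 : F' = ∅ := Finset.card_eq_zero.mp (by omega)
    simp [h1, h2]
  | succ k ih =>
    obtain ⟨f, hf, hfm⟩ := F.exists_max_image w (Finset.card_pos.mp (by omega))
    obtain ⟨f', hf', hfm'⟩ := F'.exists_max_image w' (Finset.card_pos.mp (by omega))
    -- At the threshold `w' f'` all of `F'` is counted, hence all of `F`. Removing both heaviest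
    -- elements then preserves the domination.
    have hff : w f ≤ w' f' := by
      have h1 := h (w' f')
      rw [Finset.filter_true_of_mem hfm', ← hc] at h1
      have h2 := Finset.eq_of_subset_of_card_le (Finset.filter_subset _ F) h1
      rw [← h2] at hf
      exact (Finset.mem_filter.mp hf).2
    have key := ih (F.erase f) (F'.erase f')
      (by rw [Finset.card_erase_of_mem hf, Finset.card_erase_of_mem hf', hc]) ?_
      (by rw [Finset.card_erase_of_mem hf]; omega)
    · have e1 := Finset.add_sum_erase F w hf
      have e2 := Finset.add_sum_erase F' w' hf'
      refine ⟨by linarith [key.1], fun hle => ?_⟩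
      have e3 := key.2 (by linarith)
      have e4 : w f = w' f' := by linarith [key.1]
      rw [← Finset.insert_erase hf, ← Finset.insert_erase hf', Finset.image_insert,
        Finset.image_insert, e3, e4]
    · intro t
      have h1 := h t
      rw [Finset.filter_erase, Finset.filter_erase]
      by_cases ht : w' f' ≤ t
      · rw [Finset.card_erase_of_mem (by simp [hf', ht]),
          Finset.card_erase_of_mem (by simp [hf, hff.trans ht])]
        omega
      · rw [Finset.erase_eq_of_notMem (by simp [ht])]
        by_cases ht' : w f ≤ t
        · rw [Finset.card_erase_of_mem (by simp [hf, ht']),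
            Finset.filter_true_of_mem (s := F) fun e he => (hfm e he).trans ht']
          have : (F'.filter fun e => w' e ≤ t).card < F'.card :=
            Finset.card_lt_card (Finset.filter_ssubset.mpr ⟨f', hf', ht⟩)
          omega
        · rwa [Finset.erase_eq_of_notMem (by simp [ht'])]

section GreedyForests

variable {n : ℕ} {G : SimpleGraph (Fin n)} {w : Sym2 (Fin n) → ℝ} {F T : Finset (Sym2 (Fin n))}

/-- `F` is a possible intermediate result of Kruskal's algorithm. -/
structure IsGreedyForest (G : SimpleGraph (Fin n)) (w : Sym2 (Fin n) → ℝ)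
    (F : Finset (Sym2 (Fin n))) : Prop where
  mem_edgeSet : ∀ e ∈ F, e ∈ G.edgeSet
  isAcyclic : (SimpleGraph.fromEdgeSet (F : Set (Sym2 (Fin n)))).IsAcyclic
  light : ∀ e ∈ G.edgeSet, EdgeJoined {f | f ∈ F ∧ w f ≤ w e} e ∨
    (¬ EdgeJoined (F : Set (Sym2 (Fin n))) e ∧ ∀ f ∈ F, w f ≤ w e)

theorem isGreedyForest_empty : IsGreedyForest G w ∅ where
  mem_edgeSet := by simp
  isAcyclic := by simp
  light e he := by
    refine .inr ⟨fun h => ?_, by simp⟩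
    have hd := G.not_isDiag_of_mem_edgeSet he
    induction e with | _ u v => ?_
    rw [edgeJoined_mk] at h
    simp only [Finset.coe_empty, SimpleGraph.fromEdgeSet_empty, SimpleGraph.reachable_bot] at h
    exact hd (by simpa using h)

/-- By `light`, an edge not yet joined is at least as heavy as the whole forest. By minimality of
`e` this persists after insertion, so an edge that becomes joined is joined by edges no heavier than
itself. -/
theorem IsGreedyForest.insert_min (hF : IsGreedyForest G w F) {e : Sym2 (Fin n)}
    (he : e ∈ G.edgeSet) (hc : ¬ EdgeJoined (F : Set (Sym2 (Fin n))) e)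
    (hmin : ∀ e' ∈ G.edgeSet, ¬ EdgeJoined (F : Set (Sym2 (Fin n))) e' → w e ≤ w e') :
    IsGreedyForest G w (insert e F) := by
  have hcF : e ∉ (F : Set (Sym2 (Fin n))) := fun h => hc (edgeJoined_of_mem h)
  have hsub : (F : Set (Sym2 (Fin n))) ⊆ ((insert e F : Finset _) : Set (Sym2 (Fin n))) := by
    simp
  have hle : ∀ f ∈ F, w f ≤ w e := by
    rcases hF.light e he with h | h
    · exact (hc (h.mono fun f hf => hf.1)).elim
    · exact h.2
  constructor
  · intro f hf
    rcases Finset.mem_insert.mp hf with rfl | hf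
    exacts [he, hF.mem_edgeSet f hf]
  · rw [Finset.coe_insert, acyclic_insert_iff (G.not_isDiag_of_mem_edgeSet he) hcF]
    exact ⟨hF.isAcyclic, hc⟩
  · intro e' he'
    rcases hF.light e' he' with h | ⟨h1, h2⟩
    · exact .inl (h.mono (Set.ofPred_subset_ofPred.mpr fun f hf => ⟨by simp [hf.1], hf.2⟩))
    · have hw := hmin e' he' h1
      have hall : ∀ f ∈ insert e F, w f ≤ w e' := by
        intro f hf
        rcases Finset.mem_insert.mp hf with rfl | hf
        exacts [hw, h2 f hf]
      by_cases hj : EdgeJoined ((insert e F : Finset _) : Set (Sym2 (Fin n))) e'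
      · exact .inl (hj.mono (Set.subset_ofPred.mpr fun f hf => ⟨hf, hall f hf⟩))
      · exact .inr ⟨hj, hall⟩

theorem IsGreedyForest.exists_complete (hF : IsGreedyForest G w F) :
    ∃ F', F ⊆ F' ∧ IsGreedyForest G w F' ∧
      ∀ e ∈ G.edgeSet, EdgeJoined (F' : Set (Sym2 (Fin n))) e := by
  classical
  induction hk : Fᶜ.card using Nat.strong_induction_on generalizing F with
  | _ k ih =>
  let A : Finset (Sym2 (Fin n)) := Finset.univ.filter fun e =>
    e ∈ G.edgeSet ∧ ¬ EdgeJoined (F : Set (Sym2 (Fin n))) e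
  rcases A.eq_empty_or_nonempty with hA | hA
  · refine ⟨F, subset_rfl, hF, fun e he => ?_⟩
    by_contra hn
    have : e ∈ A := by simp [A, he, hn]
    simp [hA] at this
  · obtain ⟨e, he, hm⟩ := A.exists_min_image w hA
    simp only [A, Finset.mem_filter, Finset.mem_univ, true_and] at he hm
    have heF : e ∉ F := fun h => he.2 (edgeJoined_of_mem h)
    obtain ⟨F', h1, h2⟩ := ih _ (by
      rw [← hk]
      apply Finset.card_lt_card
      rw [Finset.compl_ssubset_compl]
      exact Finset.ssubset_insert heF) (hF.insert_min he.1 he.2 fun e' h1 h2 => hm e' ⟨h1, h2⟩) rfl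
    exact ⟨F', (Finset.subset_insert _ _).trans h1, h2⟩

theorem IsSpanningForest.edgeJoined (hT : IsSpanningForest G T) {e : Sym2 (Fin n)}
    (he : e ∈ G.edgeSet) : EdgeJoined (T : Set (Sym2 (Fin n))) e := by
  by_cases h : e ∈ T
  · exact edgeJoined_of_mem h
  · have := hT.2.2 e he h
    rw [acyclic_insert_iff (G.not_isDiag_of_mem_edgeSet he) (by simpa using h)] at this
    by_contra hn
    exact this ⟨hT.2.1, hn⟩

theorem IsGreedyForest.isSpanningForest (hF : IsGreedyForest G w F)
    (hc : ∀ e ∈ G.edgeSet, EdgeJoined (F : Set (Sym2 (Fin n))) e) : IsSpanningForest G F := by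
  refine ⟨hF.mem_edgeSet, hF.isAcyclic, fun e he heF => ?_⟩
  rw [acyclic_insert_iff (G.not_isDiag_of_mem_edgeSet he) (by simpa using heF)]
  exact fun h => h.2 (hc e he)

theorem IsSpanningForest.card_le (hF : IsSpanningForest G F) (hT : IsSpanningForest G T) :
    F.card ≤ T.card :=
  card_le_card_of_edgeJoined (fun e he => G.not_isDiag_of_mem_edgeSet (hF.1 e he)) hF.2.1
    fun e he => hT.edgeJoined (hF.1 e he)

/-- For each `t`, the edges of `T` of weight at most `t` are joined by edges of `F` of weight at
most `t`; the rank inequality thus compares the counting functions at every threshold. -/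
theorem IsGreedyForest.sum_le (hF : IsGreedyForest G w F)
    (hc : ∀ e ∈ G.edgeSet, EdgeJoined (F : Set (Sym2 (Fin n))) e) (hT : IsSpanningForest G T) :
    ∑ e ∈ F, w e ≤ ∑ e ∈ T, w e ∧
      (∑ e ∈ T, w e ≤ ∑ e ∈ F, w e → F.image w = T.image w) := by
  have hS := hF.isSpanningForest hc
  refine sum_le_sum_of_count_le w w F T ((hS.card_le hT).antisymm (hT.card_le hS)) fun t => ?_
  refine card_le_card_of_edgeJoined
    (fun e he => G.not_isDiag_of_mem_edgeSet (hT.1 e (Finset.mem_filter.mp he).1)) ?_ ?_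
  · exact hT.2.1.anti (SimpleGraph.fromEdgeSet_mono (by exact_mod_cast Finset.filter_subset _ T))
  · intro e he
    obtain ⟨heT, het⟩ := Finset.mem_filter.mp he
    rcases hF.light e (hT.1 e heT) with h | h
    · exact h.mono fun f hf => by simpa using ⟨hf.1, hf.2.trans het⟩
    · exact (h.1 (hc e (hT.1 e heT))).elim

theorem IsGreedyForest.isMinWeightSpanningForest (hF : IsGreedyForest G w F)
    (hc : ∀ e ∈ G.edgeSet, EdgeJoined (F : Set (Sym2 (Fin n))) e) :
    IsMinWeightSpanningForest G w F :=
  ⟨hF.isSpanningForest hc, fun _ hT => (hF.sum_le hc hT).1⟩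

theorem IsGreedyForest.card_le (hF : IsGreedyForest G w F) (hT : IsSpanningForest G T) :
    F.card ≤ T.card := by
  obtain ⟨F', h1, h2, h3⟩ := hF.exists_complete
  exact (Finset.card_le_card h1).trans ((h2.isSpanningForest h3).card_le hT)

/-- Completing `F` greedily gives a forest as light as `T`, and the equality case of
`IsGreedyForest.sum_le` says that the same weights occur. -/
theorem IsGreedyForest.image_subset (hF : IsGreedyForest G w F)
    (hT : IsMinWeightSpanningForest G w T) : F.image w ⊆ T.image w := by
  obtain ⟨F', h1, h2, h3⟩ := hF.exists_complete
  rw [← (h2.sum_le h3 hT.1).2 (hT.2 F' (h2.isSpanningForest h3))]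
  exact Finset.image_subset_image h1

variable (G w) in
theorem exists_isMinWeightSpanningForest : ∃ F, IsMinWeightSpanningForest G w F := by
  obtain ⟨F, -, h1, h2⟩ := (isGreedyForest_empty (G := G) (w := w)).exists_complete
  exact ⟨F, h1.isMinWeightSpanningForest h2⟩

theorem IsMinWeightSpanningForest.congr_weight {w' : Sym2 (Fin n) → ℝ}
    (hF : IsMinWeightSpanningForest G w F) (h : ∀ e ∈ G.edgeSet, w e = w' e) :
    IsMinWeightSpanningForest G w' F := by
  refine ⟨hF.1, fun T hT => ?_⟩
  rw [← Finset.sum_congr rfl fun e he => h e (hF.1.1 e he),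
    ← Finset.sum_congr rfl fun e he => h e (hT.1 e he)]
  exact hF.2 T hT

end GreedyForests

/-! ### Expectations and the drift argument -/

namespace PMF

variable {α β : Type*}

theorem tsum_bind_mul (p : PMF α) (f : α → PMF β) (g : β → ℝ≥0∞) :
    ∑' b, p.bind f b * g b = ∑' a, p a * ∑' b, f a b * g b := by
  simp_rw [PMF.bind_apply, ← ENNReal.tsum_mul_right, ← ENNReal.tsum_mul_left, mul_assoc]
  exact ENNReal.tsum_comm

theorem tsum_pure_mul (a : α) (g : α → ℝ≥0∞) : ∑' b, PMF.pure a b * g b = g a := by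
  rw [tsum_eq_single a (by intro b hb; simp [PMF.pure_apply, hb])]
  simp

theorem tsum_map_mul (p : PMF α) (f : α → β) (g : β → ℝ≥0∞) :
    ∑' b, p.map f b * g b = ∑' a, p a * g (f a) := by
  rw [← PMF.bind_pure_comp, tsum_bind_mul]
  simp_rw [Function.comp_apply, tsum_pure_mul]

theorem tsum_mul_mono_support (p : PMF α) {f g : α → ℝ≥0∞} (h : ∀ a ∈ p.support, f a ≤ g a) :
    ∑' a, p a * f a ≤ ∑' a, p a * g a := by
  refine ENNReal.tsum_le_tsum fun a => ?_
  by_cases ha : p a = 0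
  · simp [ha]
  · gcongr
    exact h a ((p.mem_support_iff a).mpr ha)

end PMF

namespace Channel

section Drift

variable {n m : ℕ} (alg : Algorithm) (inp : Input n m)

theorem invariant_historyAt {I : ℕ → History n → Prop} (h0 : I 0 [])
    (hI : ∀ t h, I t h → ∀ h' ∈ (alg.step inp h).support, I (t + 1) h') (t : ℕ) :
    ∀ h ∈ (alg.historyAt inp t).support, I t h := by
  induction t with
  | zero => simpa [Algorithm.historyAt] using h0
  | succ t ih =>
    intro h hh
    rw [Algorithm.historyAt, PMF.mem_support_bind_iff] at hh
    obtain ⟨g, hg, hh⟩ := hh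
    exact hI t g (ih g hg) h hh

/-- If the potential `Φ` decreases by at least one in expectation in each step, then the expected
running time is at most the initial potential. -/
theorem expectedTime_le_of_drift {I : History n → Prop} (Φ : History n → ℝ≥0∞) (h0 : I [])
    (hI : ∀ h, I h → ∀ h' ∈ (alg.step inp h).support, I h')
    (hd : ∀ h, I h → alg.Running h → ∑' h', alg.step inp h h' * Φ h' + 1 ≤ Φ h) :
    alg.expectedTime inp ≤ Φ [] := by
  classical
  have hinv := invariant_historyAt alg inp (I := fun _ => I) h0 fun _ => hI
  -- The expected potential drops in step `t` by at least the probability that the step is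
  -- performed; these inequalities telescope.
  have hstep : ∀ t, ∑' h, alg.historyAt inp (t + 1) h * Φ h +
      (alg.historyAt inp t).toOuterMeasure {h | alg.Running h} ≤
        ∑' h, alg.historyAt inp t h * Φ h := by
    intro t
    rw [Algorithm.historyAt, PMF.tsum_bind_mul, PMF.toOuterMeasure_apply]
    have : ∀ h, Set.indicator {h | alg.Running h} (⇑(alg.historyAt inp t)) h =
        alg.historyAt inp t h * (if alg.Running h then 1 else 0) := by
      intro h
      by_cases hr : alg.Running h <;> simp [hr]
    simp_rw [this]
    rw [← ENNReal.tsum_add]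
    simp_rw [← mul_add]
    refine PMF.tsum_mul_mono_support _ fun h hh => ?_
    by_cases hr : alg.Running h
    · simpa [hr] using hd h (hinv t h hh) hr
    · have hq : alg.query n h = none := by simpa [Algorithm.Running] using hr
      have hs : alg.step inp h = PMF.pure h := by simp [Algorithm.step, hq]
      simp [hr, hs]
  have hsum : ∀ N, ∑' h, alg.historyAt inp N h * Φ h +
      ∑ t ∈ Finset.range N, (alg.historyAt inp t).toOuterMeasure {h | alg.Running h} ≤ Φ [] := by
    intro N
    induction N with
    | zero => simp [Algorithm.historyAt]
    | succ N ih =>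
      rw [Finset.sum_range_succ, add_comm (∑ t ∈ Finset.range N, _), ← add_assoc]
      exact (add_le_add (hstep N) le_rfl).trans ih
  rw [Algorithm.expectedTime]
  exact ENNReal.tsum_le_of_sum_range_le fun N => le_add_self.trans (hsum N)

end Drift

/-! ### The set of transmitting stations -/

section RandomSubset

variable {m : ℕ} {S : Finset (Fin m)} {p : ℝ≥0} {hp : p ≤ 1}

theorem randomSubset_apply (A : Finset (Fin m)) : randomSubset S p hp A =
    if A ⊆ S then ((p ^ A.card * (1 - p) ^ (S.card - A.card) : ℝ≥0) : ℝ≥0∞) else 0 := rfl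

theorem subset_of_mem_support_randomSubset {A : Finset (Fin m)}
    (hA : A ∈ (randomSubset S p hp).support) : A ⊆ S := by
  by_contra h
  rw [PMF.mem_support_iff, randomSubset_apply, if_neg h] at hA
  exact hA rfl

theorem randomSubset_one (h1 : (1 : ℝ≥0) ≤ 1) : randomSubset S 1 h1 = PMF.pure S := by
  ext A
  rw [randomSubset_apply, PMF.pure_apply]
  by_cases hA : A = S
  · simp [hA]
  · rw [if_neg hA, ite_eq_right_iff]
    intro hs
    have := Finset.card_lt_card (hs.ssubset_of_ne hA)
    have : S.card - A.card ≠ 0 := by omega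
    simp [this]

theorem eq_of_mem_support_randomSubset_one {A : Finset (Fin m)} (h1 : p = 1)
    (hA : A ∈ (randomSubset S p hp).support) : A = S := by
  subst h1
  simpa [randomSubset_one] using hA

/-- Passing to a finite real sum makes subtraction available for the drift estimates. -/
theorem tsum_randomSubset_mul (f : Finset (Fin m) → ℕ) :
    ∑' A, randomSubset S p hp A * (f A : ℝ≥0∞) = ENNReal.ofReal
      (∑ A ∈ S.powerset, (p : ℝ) ^ A.card * (1 - (p : ℝ)) ^ (S.card - A.card) * f A) := by
  rw [tsum_eq_sum (s := S.powerset) (by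
    intro A hA
    rw [Finset.mem_powerset] at hA
    rw [randomSubset_apply, if_neg hA, zero_mul])]
  have hp' : (0 : ℝ) ≤ 1 - p := by
    have : (p : ℝ) ≤ 1 := by exact_mod_cast hp
    linarith
  rw [ENNReal.ofReal_sum_of_nonneg fun A _ => by positivity]
  refine Finset.sum_congr rfl fun A hA => ?_
  rw [randomSubset_apply, if_pos (Finset.mem_powerset.mp hA), ENNReal.ofReal_mul (by positivity),
    ENNReal.ofReal_natCast]
  congr 1
  rw [← ENNReal.ofReal_coe_nnreal]
  congr 1
  push_cast [NNReal.coe_sub hp]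
  rfl

/-- The expectation of a function that takes the same value on all sets with at least two
elements. -/
theorem sum_powerset_eq_of_card_two_le (p c : ℝ) (f : Finset (Fin m) → ℝ)
    (hf : ∀ A, 2 ≤ A.card → f A = c) :
    ∑ A ∈ S.powerset, p ^ A.card * (1 - p) ^ (S.card - A.card) * f A =
      (1 - p) ^ S.card * f ∅ + p * (1 - p) ^ (S.card - 1) * ∑ i ∈ S, f {i} +
        (1 - (1 - p) ^ S.card - S.card * (p * (1 - p) ^ (S.card - 1))) * c := by
  have h1 : ∑ A ∈ S.powerset, p ^ A.card * (1 - p) ^ (S.card - A.card) = 1 := by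
    rw [Finset.sum_pow_mul_eq_add_pow]; simp
  -- After subtracting `c`, only the empty set and the singletons contribute.
  have h2 : ∑ A ∈ S.powerset, p ^ A.card * (1 - p) ^ (S.card - A.card) * (f A - c) =
      (1 - p) ^ S.card * (f ∅ - c) + p * (1 - p) ^ (S.card - 1) * ∑ i ∈ S, (f {i} - c) := by
    rw [← Finset.sum_subset (s₁ := insert ∅ (S.image fun i => {i}))]
    · rw [Finset.sum_insert (by simp), Finset.sum_image (by simp), Finset.mul_sum]
      simp
    · intro A hA
      simp only [Finset.mem_insert, Finset.mem_image] at hA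
      rcases hA with rfl | ⟨i, hi, rfl⟩ <;> simp [*]
    · intro A hA hA'
      simp only [Finset.mem_insert, Finset.mem_image, not_or, not_exists, not_and] at hA'
      rw [Finset.mem_powerset] at hA
      rw [hf A, sub_self, mul_zero]
      by_contra hlt
      have : A.card = 0 ∨ A.card = 1 := by omega
      rcases this with h | h
      · exact hA'.1 (Finset.card_eq_zero.mp h)
      · obtain ⟨i, rfl⟩ := Finset.card_eq_one.mp h
        exact hA'.2 i (hA (by simp)) rfl
  simp only [mul_sub, Finset.sum_sub_distrib, ← Finset.sum_mul, h1, Finset.sum_const,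
    nsmul_eq_mul] at h2
  linarith

end RandomSubset

/-! ### Adapting the transmission probability -/

/-- The part of the potential that measures how well the probability `2⁻ᵏ` fits to `s` stations. -/
def guessCost (s k : ℕ) : ℕ := 2 * k + 4 * (Nat.size s - k)

theorem guessCost_mono {s s' : ℕ} (h : s ≤ s') (k : ℕ) : guessCost s k ≤ guessCost s' k := by
  have := Nat.size_le_size h
  unfold guessCost
  omega

/-- With p = 2⁻ᵏ, Bernoulli's inequality gives at least 1/2 for the exponent 1/(2p), and `s` is at
most eight times this exponent; hence (1/2)⁸. -/
theorem one_sub_two_pow_pow_ge {k s : ℕ} (hk : 1 ≤ k) (hs : s ≤ 4 * 2 ^ k) :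
    (1 / 256 : ℝ) ≤ (1 - (2 ^ k)⁻¹) ^ s := by
  obtain ⟨j, rfl⟩ : ∃ j, k = j + 1 := ⟨k - 1, by omega⟩
  set p : ℝ := (2 ^ (j + 1))⁻¹ with hp
  have hp0 : 0 < p := by positivity
  have hpj : (2 : ℝ) ^ j * p = 1 / 2 := by
    rw [hp, pow_succ]; field_simp
  have hp1 : p ≤ 1 / 2 := by
    have : (1 : ℝ) ≤ 2 ^ j := one_le_pow₀ (by norm_num)
    nlinarith
  have h1 : (1 / 2 : ℝ) ≤ (1 - p) ^ (2 ^ j) := by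
    have := one_add_mul_le_pow (a := -p) (by linarith) (2 ^ j)
    push_cast at this
    rw [← sub_eq_add_neg] at this
    linarith
  calc (1 / 256 : ℝ) = (1 / 2) ^ 8 := by norm_num
    _ ≤ ((1 - p) ^ (2 ^ j)) ^ 8 := by gcongr
    _ = (1 - p) ^ (2 ^ j * 8) := by rw [pow_mul]
    _ ≤ (1 - p) ^ s := by
      apply pow_le_pow_of_le_one (by linarith) (by linarith)
      rw [pow_succ] at hs
      omega

/-- One step of searching for the right probability: `v₀`, `v₁`, `v₂` are the changes of the
potential in case of silence, a successful transmission, and a collision. -/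
theorem guess_drift {s k : ℕ} {v₀ v₁ v₂ : ℝ} (hsk : 1 ≤ s ∨ 1 ≤ k)
    (h0 : 1 ≤ k → v₀ ≤ (guessCost s (k - 1) : ℝ) - guessCost s k) (h1 : v₁ ≤ -1536)
    (h2 : v₂ ≤ (guessCost s (k + 1) : ℝ) - guessCost s k) :
    (1 - (2 ^ k)⁻¹) ^ s * v₀ + s * ((2 ^ k)⁻¹ * (1 - (2 ^ k)⁻¹) ^ (s - 1)) * v₁ +
      (1 - (1 - (2 ^ k)⁻¹) ^ s - s * ((2 ^ k)⁻¹ * (1 - (2 ^ k)⁻¹) ^ (s - 1))) * v₂ ≤ -1 := by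
  -- As a function of `k`, `guessCost s k` falls with slope 2 up to `Nat.size s` and then rises with
  -- slope 2. For `k = 0` every participant transmits, so silence is excluded here.
  rcases Nat.eq_zero_or_pos k with rfl | hk
  · have hs : 1 ≤ s := by omega
    have hL : 1 ≤ Nat.size s := Nat.size_pos.mpr hs
    have h2' : v₂ ≤ -2 := by
      have : guessCost s (0 + 1) + 2 = guessCost s 0 := by unfold guessCost; omega
      have : (guessCost s (0 + 1) : ℝ) + 2 = guessCost s 0 := by exact_mod_cast this
      linarith
    rcases Nat.eq_or_lt_of_le hs with rfl | hs2
    · norm_num; linarith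
    · have e1 : s ≠ 0 := by omega
      have e2 : s - 1 ≠ 0 := by omega
      simp [e1, e2]
      linarith
  · have hp0 : (0 : ℝ) < (2 ^ k)⁻¹ := by positivity
    have hpk : (2 : ℝ) ^ k * (2 ^ k)⁻¹ = 1 := by field_simp
    have hp1 : ((2 : ℝ) ^ k)⁻¹ ≤ 1 / 2 := by
      rw [one_div]
      apply inv_anti₀ (by norm_num)
      exact le_self_pow₀ (by norm_num) (by omega)
    have hlow := fun h => one_sub_two_pow_pow_ge (k := k) (s := s) hk h
    have hbern := one_add_mul_le_pow (a := -((2 : ℝ) ^ k)⁻¹) (by linarith) s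
    rw [← sub_eq_add_neg] at hbern
    -- From (1 - p)(1 + p) ≤ 1: this bounds the probability of silence above, and also shows that
    -- the collision probability is nonnegative.
    have hup : ∀ j : ℕ, (1 - ((2 : ℝ) ^ k)⁻¹) ^ j * (1 + j * (2 ^ k)⁻¹) ≤ 1 := by
      intro j
      have hb := one_add_mul_le_pow (a := ((2 : ℝ) ^ k)⁻¹) (by linarith) j
      have hnn : 0 ≤ (1 - ((2 : ℝ) ^ k)⁻¹) ^ j := pow_nonneg (by linarith) _
      calc _ ≤ (1 - ((2 : ℝ) ^ k)⁻¹) ^ j * (1 + (2 ^ k)⁻¹) ^ j := by gcongr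
        _ = ((1 - ((2 : ℝ) ^ k)⁻¹) * (1 + (2 ^ k)⁻¹)) ^ j := by rw [mul_pow]
        _ ≤ 1 := pow_le_one₀ (by nlinarith) (by nlinarith)
    have hq1 : (s * (2 ^ k)⁻¹ : ℝ) * (1 - (2 ^ k)⁻¹) ^ s ≤
        s * ((2 ^ k)⁻¹ * (1 - (2 ^ k)⁻¹) ^ (s - 1)) := by
      rw [mul_assoc]
      gcongr 2
      exact pow_le_pow_of_le_one (by linarith) (by linarith) (by omega)
    have hq2 : 0 ≤ 1 - (1 - (2 ^ k)⁻¹) ^ s - s * (((2 : ℝ) ^ k)⁻¹ * (1 - (2 ^ k)⁻¹) ^ (s - 1)) := by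
      rcases Nat.eq_zero_or_pos s with rfl | hs
      · simp
      · obtain ⟨j, rfl⟩ : ∃ j, s = j + 1 := ⟨s - 1, by omega⟩
        have := hup j
        rw [Nat.add_sub_cancel, pow_succ]
        push_cast
        nlinarith
    have hup := hup s
    have hq0 : 0 ≤ (1 - ((2 : ℝ) ^ k)⁻¹) ^ s := pow_nonneg (by linarith) _
    set q₀ := (1 - ((2 : ℝ) ^ k)⁻¹) ^ s
    set q₁ := s * (((2 : ℝ) ^ k)⁻¹ * (1 - (2 ^ k)⁻¹) ^ (s - 1))
    set l : ℝ := s * (2 ^ k)⁻¹ with hl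
    have hl0 : 0 ≤ l := by positivity
    have hq1' : 0 ≤ q₁ := (mul_nonneg hl0 hq0).trans hq1
    have h0 := h0 hk
    have hv1 : q₁ * v₁ ≤ q₁ * (-1536) := by gcongr
    rcases lt_or_ge (Nat.size s) k with hL | hL
    -- Here `k` is too large: the expected number `l` of transmitters is at most 1/2, so silence or
    -- success dominates.
    · have e0 : guessCost s (k - 1) + 2 = guessCost s k := by unfold guessCost; omega
      have e2 : guessCost s (k + 1) = guessCost s k + 2 := by unfold guessCost; omega
      have e0' : (guessCost s (k - 1) : ℝ) + 2 = guessCost s k := by exact_mod_cast e0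
      have e2' : (guessCost s (k + 1) : ℝ) = guessCost s k + 2 := by exact_mod_cast e2
      have hv0 : q₀ * v₀ ≤ q₀ * (-2) := by gcongr; linarith
      have hv2 : (1 - q₀ - q₁) * v₂ ≤ (1 - q₀ - q₁) * 2 := by gcongr; linarith
      have hs : s < 2 ^ (k - 1) := Nat.size_le.mp (by omega)
      have hs' : 2 * s ≤ 2 ^ k := by
        obtain ⟨j, rfl⟩ : ∃ j, k = j + 1 := ⟨k - 1, by omega⟩
        simp only [Nat.add_sub_cancel] at hs
        rw [pow_succ]; omega
      have hs'' : (2 : ℝ) * s ≤ 2 ^ k := by exact_mod_cast hs'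
      have hl1 : l ≤ 1 / 2 := by
        have := mul_le_mul_of_nonneg_right hs'' hp0.le
        rw [hpk] at this
        linarith
      nlinarith
    · have e0 : guessCost s (k - 1) = guessCost s k + 2 := by unfold guessCost; omega
      have e0' : (guessCost s (k - 1) : ℝ) = guessCost s k + 2 := by exact_mod_cast e0
      have hv0 : q₀ * v₀ ≤ q₀ * 2 := by gcongr; linarith
      rcases le_total s (4 * 2 ^ k) with hs4 | hs4
      -- Here `k` fits: 1/2 ≤ l and silence has probability at least 1/256, so success has
      -- probability at least 1/512. Its gain 1536 = 3 · 512 outweighs a loss of at most 2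
      -- otherwise.
      · have e2 : guessCost s (k + 1) ≤ guessCost s k + 2 := by unfold guessCost; omega
        have e2' : (guessCost s (k + 1) : ℝ) ≤ guessCost s k + 2 := by exact_mod_cast e2
        have hv2 : (1 - q₀ - q₁) * v₂ ≤ (1 - q₀ - q₁) * 2 := by gcongr; linarith
        have hs : 2 ^ (k - 1) ≤ s := Nat.lt_size.mp (by omega)
        have hs' : 2 ^ k ≤ 2 * s := by
          obtain ⟨j, rfl⟩ : ∃ j, k = j + 1 := ⟨k - 1, by omega⟩
          simp only [Nat.add_sub_cancel] at hs
          rw [pow_succ]; omega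
        have hs'' : (2 : ℝ) ^ k ≤ 2 * s := by exact_mod_cast hs'
        have hl1 : 1 / 2 ≤ l := by
          have := mul_le_mul_of_nonneg_right hs'' hp0.le
          rw [hpk] at this
          linarith
        have := hlow hs4
        nlinarith
      -- Here `k` is too small: `l ≥ 4` makes silence have probability at most 1/5.
      · have hLk : k < Nat.size s := by
          rw [Nat.lt_size]; omega
        have e2 : guessCost s (k + 1) + 2 = guessCost s k := by unfold guessCost; omega
        have e2' : (guessCost s (k + 1) : ℝ) + 2 = guessCost s k := by exact_mod_cast e2
        have hv2 : (1 - q₀ - q₁) * v₂ ≤ (1 - q₀ - q₁) * (-2) := by gcongr; linarith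
        have hs'' : (4 : ℝ) * 2 ^ k ≤ s := by exact_mod_cast hs4
        have hl1 : 4 ≤ l := by
          have := mul_le_mul_of_nonneg_right hs'' hp0.le
          rw [mul_assoc, hpk] at this
          linarith
        nlinarith

/-- Choosing an element of `S` uniformly at random halves in expectation the number of elements
with a smaller weight. -/
theorem two_mul_sum_size_add_card_le {α : Type*} (S : Finset α) (w : α → ℝ) :
    2 * ∑ i ∈ S, Nat.size (S.filter fun j => w j < w i).card + S.card ≤
      2 * (S.card * Nat.size S.card) := by
  classical
  let r : α → ℕ := fun i => (S.filter fun j => w j < w i).card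
  change 2 * ∑ i ∈ S, Nat.size (r i) + _ ≤ _
  let B := S.filter fun i => S.card ≤ 2 * r i
  let A := S.filter fun i => ¬ S.card ≤ 2 * r i
  have hAB : B.card + A.card = S.card := Finset.card_filter_add_card_filter_not _
  -- Everything strictly lighter than the lightest element of `B` lies in `A`, and that is at least
  -- half of `S`.
  have hA : S.card ≤ 2 * A.card := by
    rcases B.eq_empty_or_nonempty with hB | hB
    · rw [hB, Finset.card_empty] at hAB; omega
    · obtain ⟨i, hi, him⟩ := B.exists_min_image w hB
      have h1 : r i ≤ A.card := by
        refine Finset.card_le_card fun j hj => ?_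
        rw [Finset.mem_filter] at hj ⊢
        refine ⟨hj.1, fun hle => ?_⟩
        exact absurd hj.2 (not_lt.mpr (him j (Finset.mem_filter.mpr ⟨hj.1, hle⟩)))
      have := (Finset.mem_filter.mp hi).2
      omega
  -- An element of `A` has fewer than half of `S` below it, so the bit length drops by at least one.
  have hsize : ∀ i ∈ S, Nat.size (r i) + (if ¬ S.card ≤ 2 * r i then 1 else 0) ≤
      Nat.size S.card := by
    intro i _
    split_ifs with h
    · exact Nat.size_le_size (Finset.card_le_card (Finset.filter_subset _ _))
    · have h2 := Nat.lt_size_self S.card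
      have h3 : Nat.size S.card ≠ 0 := by
        intro h0
        rw [Nat.size_eq_zero] at h0
        omega
      obtain ⟨j, hj⟩ := Nat.exists_eq_succ_of_ne_zero h3
      rw [hj, Nat.succ_eq_add_one] at h2 ⊢
      rw [pow_succ] at h2
      have h1 : r i < 2 ^ j := by omega
      have := Nat.size_le.mpr h1
      omega
  have := Finset.sum_le_sum hsize
  rw [Finset.sum_add_distrib, ← Finset.card_filter, Finset.sum_const, smul_eq_mul] at this
  change _ + A.card ≤ _ at this
  omega

end Channel

namespace Channel

/-! ### The algorithm -/

/-- The phases of the randomized search. In `search best` the stations look for the minimum weight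
of an edge that connects different trees of the current forest, `best` being the lightest such
edge heard so far in this phase, with its weight. In `collect x` the edges of weight `x` are
added to the forest. -/
inductive Phase (n : ℕ)
  | search (best : Option (Sym2 (Fin n) × ℝ))
  | collect (x : ℝ)
  | finished

/-- Edges of weight `x` take part in the phase. -/
def Phase.Eligible {n : ℕ} (x : ℝ) : Phase n → Prop
  | .search none => True
  | .search (some b) => x < b.2
  | .collect y => x = y
  | .finished => False

/-- The state of the randomized search: the current forest, the current phase, and the current
guess `k`, which stands for the transmission probability `2⁻ᵏ`. -/
structure Search (n : ℕ) where
  forest : Finset (Sym2 (Fin n))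
  phase : Phase n
  guess : ℕ

/-- The query of the randomized search. -/
noncomputable def Search.query {n : ℕ} (s : Search n) : Query n where
  specified _ e x := ¬ EdgeJoined (s.forest : Set (Sym2 (Fin n))) e ∧ s.phase.Eligible x
  prob := (2 ^ s.guess)⁻¹
  prob_le_one := inv_le_one_of_one_le₀ (one_le_pow₀ (by norm_num))
  content := .edgeAndWeight

/-- The state after it turned out that no station takes part in the current phase. -/
def Search.nextPhase {n : ℕ} (s : Search n) : Search n :=
  match s.phase with
  | .search none => { s with phase := .finished }
  | .search (some b) => { s with forest := insert b.1 s.forest, phase := .collect b.2 }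
  | .collect _ => { s with phase := .search none }
  | .finished => s

/-- The state after the edge `e` of weight `x` was heard. -/
def Search.hear {n : ℕ} (s : Search n) (e : Sym2 (Fin n)) (x : ℝ) : Search n :=
  match s.phase with
  | .search _ => { s with phase := .search (some (e, x)) }
  | .collect _ => { s with forest := insert e s.forest }
  | .finished => s

/-- The reaction of the randomized search to the feedback. -/
def Search.next {n : ℕ} (s : Search n) : Feedback n → Search n
  -- At guess 0 the probability is 1, so silence proves that no station takes part.
  | .silence => if s.guess = 0 then s.nextPhase else { s with guess := s.guess - 1 }
  | .collision => { s with guess := s.guess + 1 }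
  | .heard (.edgeAndWeight e x) => s.hear e x
  | .heard _ => s

/-- The state of the deterministic scan of all the stations, in the order of their IDs. -/
structure Scan (n : ℕ) where
  count : ℕ
  known : Finset (Sym2 (Fin n))
  weight : Sym2 (Fin n) → ℝ
  finished : Bool

/-- The query of the scan. -/
def Scan.query {n : ℕ} (s : Scan n) : Query n where
  specified p _ _ := p = s.count + 1
  prob := 1
  prob_le_one := le_rfl
  content := .edgeAndWeight

/-- The reaction of the scan to the feedback. -/
def Scan.next {n : ℕ} (s : Scan n) : Feedback n → Scan n
  | .heard (.edgeAndWeight e x) =>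
    { s with
      count := s.count + 1
      known := insert e s.known
      weight := Function.update s.weight e x }
  -- A single ID queried with probability 1 cannot cause a collision; silence means that the IDs are
  -- exhausted.
  | _ => { s with finished := true }

/-- The state of the algorithm, which alternates between the scan and the randomized search. -/
structure State (n : ℕ) where
  scanTurn : Bool
  scan : Scan n
  search : Search n

/-- The initial state. -/
def State.init (n : ℕ) : State n where
  scanTurn := true
  scan := ⟨0, ∅, fun _ => 0, false⟩
  search := ⟨∅, .search none, 0⟩

/-- The reaction of the algorithm to the feedback. -/
def State.next {n : ℕ} (s : State n) (f : Feedback n) : State n :=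
  if s.scanTurn then { s with scanTurn := false, scan := s.scan.next f }
  else { s with scanTurn := true, search := s.search.next f }

/-- The scan or the search is finished. -/
def State.Halted {n : ℕ} (s : State n) : Prop :=
  s.scan.finished = true ∨ s.search.phase = .finished

open Classical in
/-- The query of the algorithm. -/
noncomputable def State.query {n : ℕ} (s : State n) : Option (Query n) :=
  if s.Halted then none else some (if s.scanTurn then s.scan.query else s.search.query)

open Classical in
/-- The output of the algorithm. -/
noncomputable def State.output {n : ℕ} (s : State n) : Finset (Sym2 (Fin n)) :=
  if s.scan.finished then
    (exists_isMinWeightSpanningForest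
      (SimpleGraph.fromEdgeSet (s.scan.known : Set (Sym2 (Fin n)))) s.scan.weight).choose
  else s.search.forest

/-- The state after a history. -/
def stateAfter {n : ℕ} (h : History n) : State n := h.foldl State.next (State.init n)

theorem stateAfter_concat {n : ℕ} (h : History n) (f : Feedback n) :
    stateAfter (h ++ [f]) = (stateAfter h).next f := by
  simp [stateAfter]

/-- The algorithm that finds a minimum-weight spanning forest. -/
noncomputable def forestAlgorithm : Algorithm where
  query _ h := (stateAfter h).query
  output _ h := (stateAfter h).output

theorem forestAlgorithm_running_iff {n : ℕ} {h : History n} :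
    forestAlgorithm.Running h ↔ ¬ (stateAfter h).Halted := by
  simp [Algorithm.Running, forestAlgorithm, State.query]

/-! ### Feedback and the participating stations -/

section Input

variable {n m : ℕ} (inp : Input n m)

theorem Input.edge_mem (i : Fin m) : inp.edge i ∈ inp.graph.edgeSet := (inp.holds i).2

theorem Input.exists_edge_eq {e : Sym2 (Fin n)} (he : e ∈ inp.graph.edgeSet) :
    ∃ i, inp.edge i = e :=
  ⟨inp.holds.symm ⟨e, he⟩, by simp [Input.edge]⟩

theorem Input.feedback_empty (c : Content) : inp.feedback c ∅ = .silence := by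
  simp [Input.feedback]

theorem Input.feedback_singleton (c : Content) (i : Fin m) :
    inp.feedback c {i} = .heard (c.message (inp.edge i) (inp.weight (inp.edge i))) := by
  simp [Input.feedback]

theorem Input.feedback_of_two_le (c : Content) {A : Finset (Fin m)} (hA : 2 ≤ A.card) :
    inp.feedback c A = .collision := by
  rw [← Finset.length_toList] at hA
  unfold Input.feedback
  split <;> simp_all

theorem Input.mem_specified {q : Query n} {i : Fin m} : i ∈ inp.specified q ↔
    q.specified ((i : ℕ) + 1) (inp.edge i) (inp.weight (inp.edge i)) := by
  simp [Input.specified]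

/-- The stations that take part in the current phase of the search. -/
noncomputable def Input.active (s : Search n) : Finset (Fin m) := inp.specified s.query

theorem Input.mem_active {s : Search n} {i : Fin m} : i ∈ inp.active s ↔
    ¬ EdgeJoined (s.forest : Set (Sym2 (Fin n))) (inp.edge i) ∧
      s.phase.Eligible (inp.weight (inp.edge i)) :=
  inp.mem_specified

theorem Input.not_eligible_of_active_eq_empty {s : Search n} (hs : inp.active s = ∅)
    {e : Sym2 (Fin n)} (he : e ∈ inp.graph.edgeSet)
    (hc : ¬ EdgeJoined (s.forest : Set (Sym2 (Fin n))) e) :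
    ¬ s.phase.Eligible (inp.weight e) := by
  intro h
  obtain ⟨i, rfl⟩ := inp.exists_edge_eq he
  have : i ∈ inp.active s := inp.mem_active.mpr ⟨hc, h⟩
  simp [hs] at this

theorem Input.card_active_le (s : Search n) : (inp.active s).card ≤ m := by
  simpa using Finset.card_le_univ (inp.active s)

end Input

/-! ### Invariants -/

section Invariants

variable {n m : ℕ} {inp : Input n m}

/-- The invariant of the phases of the search. -/
def PhaseInvariant (inp : Input n m) (F : Finset (Sym2 (Fin n))) : Phase n → Prop
  | .search best =>
    (∀ e ∈ inp.graph.edgeSet, ¬ EdgeJoined (F : Set (Sym2 (Fin n))) e →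
      ∀ f ∈ F, inp.weight f < inp.weight e) ∧
    ∀ b ∈ best, b.1 ∈ inp.graph.edgeSet ∧ ¬ EdgeJoined (F : Set (Sym2 (Fin n))) b.1 ∧
      b.2 = inp.weight b.1
  | .collect x =>
    x ∈ F.image inp.weight ∧
    ∀ e ∈ inp.graph.edgeSet, ¬ EdgeJoined (F : Set (Sym2 (Fin n))) e →
      x ≤ inp.weight e ∧ ∀ f ∈ F, inp.weight f ≤ x
  | .finished => ∀ e ∈ inp.graph.edgeSet, EdgeJoined (F : Set (Sym2 (Fin n))) e

/-- The invariant of the search. -/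
structure SearchInvariant (inp : Input n m) (s : Search n) : Prop where
  greedy : IsGreedyForest inp.graph inp.weight s.forest
  phase : PhaseInvariant inp s.forest s.phase

/-- No participants means, by phase: no edge joins different trees; none is lighter than `best`, so
adding `best` is a Kruskal step; or none of weight `x` is left, so the remaining ones are strictly
heavier than the forest. -/
theorem SearchInvariant.nextPhase {s : Search n} (hs : SearchInvariant inp s)
    (h0 : inp.active s = ∅) : SearchInvariant inp s.nextPhase := by
  obtain ⟨F, ph, k⟩ := s
  obtain ⟨hg, hp⟩ := hs
  have hn := fun e he hc => inp.not_eligible_of_active_eq_empty h0 (e := e) he hc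
  match ph with
  | .search none =>
    refine ⟨hg, fun e he => ?_⟩
    by_contra hc
    exact hn e he hc trivial
  | .search (some b) =>
    obtain ⟨hp1, hp2⟩ := hp
    obtain ⟨hb1, hb2, hb3⟩ := hp2 b rfl
    have hmin : ∀ e ∈ inp.graph.edgeSet, ¬ EdgeJoined (F : Set (Sym2 (Fin n))) e →
        inp.weight b.1 ≤ inp.weight e := fun e he hc => by
      rw [← hb3]; exact not_lt.mp (hn e he hc)
    refine ⟨hg.insert_min hb1 hb2 hmin, ?_, fun e he hc => ⟨?_, ?_⟩⟩
    · rw [hb3]; exact Finset.mem_image_of_mem _ (Finset.mem_insert_self _ _)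
    · rw [hb3]
      exact hmin e he fun h => hc (h.mono (Finset.coe_subset.mpr (Finset.subset_insert _ _)))
    · intro f hf
      rcases Finset.mem_insert.mp hf with rfl | hf
      exacts [hb3.ge, hb3 ▸ (hp1 b.1 hb1 hb2 f hf).le]
  | .collect x =>
    obtain ⟨hp1, hp2⟩ := hp
    refine ⟨hg, fun e he hc f hf => ?_, by simp⟩
    obtain ⟨h1, h2⟩ := hp2 e he hc
    exact (h2 f hf).trans_lt (lt_of_le_of_ne h1 fun h => hn e he hc h.symm)
  | .finished => exact ⟨hg, hp⟩

theorem SearchInvariant.hear {s : Search n} (hs : SearchInvariant inp s) {i : Fin m}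
    (hi : i ∈ inp.active s) :
    SearchInvariant inp (s.hear (inp.edge i) (inp.weight (inp.edge i))) := by
  obtain ⟨F, ph, k⟩ := s
  obtain ⟨hg, hp⟩ := hs
  obtain ⟨hi1, hi2⟩ := inp.mem_active.mp hi
  have hE := inp.edge_mem i
  match ph with
  | .search b =>
    refine ⟨hg, hp.1, fun b' hb' => ?_⟩
    obtain rfl : (inp.edge i, inp.weight (inp.edge i)) = b' := by simpa using hb'
    exact ⟨hE, hi1, rfl⟩
  | .collect x =>
    obtain ⟨hp1, hp2⟩ := hp
    have hw : inp.weight (inp.edge i) = x := hi2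
    refine ⟨hg.insert_min hE hi1 fun e he hc => hw.le.trans (hp2 e he hc).1, ?_, ?_⟩
    · exact Finset.image_subset_image (Finset.subset_insert _ _) hp1
    · intro e he hc
      obtain ⟨h1, h2⟩ := hp2 e he fun h => hc (h.mono (Finset.coe_subset.mpr (Finset.subset_insert _ _)))
      refine ⟨h1, fun f hf => ?_⟩
      rcases Finset.mem_insert.mp hf with rfl | hf
      exacts [hw.le, h2 f hf]
  | .finished => exact ⟨hg, hp⟩

/-- In the search, the transmitting stations `A` are possible. -/
def PossibleTransmission (inp : Input n m) (s : Search n) (A : Finset (Fin m)) : Prop :=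
  A ⊆ inp.active s ∧ (s.guess = 0 → A = inp.active s)

theorem SearchInvariant.next {s : Search n} (hs : SearchInvariant inp s) {A : Finset (Fin m)}
    (hA : PossibleTransmission inp s A) :
    SearchInvariant inp (s.next (inp.feedback .edgeAndWeight A)) := by
  rcases Nat.lt_or_ge A.card 2 with hc | hc
  · have : A.card = 0 ∨ A.card = 1 := by omega
    rcases this with hc | hc
    · obtain rfl := Finset.card_eq_zero.mp hc
      rw [inp.feedback_empty]
      by_cases hk : s.guess = 0
      · simpa [Search.next, hk] using hs.nextPhase (hA.2 hk).symm
      · simpa [Search.next, hk] using ⟨hs.greedy, hs.phase⟩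
    · obtain ⟨i, rfl⟩ := Finset.card_eq_one.mp hc
      rw [inp.feedback_singleton]
      exact hs.hear (hA.1 (by simp))
  · rw [inp.feedback_of_two_le _ hc]
    exact ⟨hs.greedy, hs.phase⟩

/-- The edges that the search uses have been heard. -/
structure SearchRevealed (h : History n) (s : Search n) : Prop where
  forest : ∀ e ∈ s.forest, h.Reveals e
  best : ∀ b, s.phase = .search (some b) → h.Reveals b.1

theorem History.Reveals.concat {h : History n} {e : Sym2 (Fin n)} (he : h.Reveals e)
    (f : Feedback n) : History.Reveals (h ++ [f]) e := by
  obtain ⟨msg, h1, h2⟩ := he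
  exact ⟨msg, by simp [h1], h2⟩

theorem reveals_concat_heard (h : History n) (e : Sym2 (Fin n)) (x : ℝ) :
    History.Reveals (h ++ [.heard (.edgeAndWeight e x)]) e :=
  ⟨.edgeAndWeight e x, by simp, rfl⟩

theorem SearchRevealed.concat {h : History n} {s : Search n} (hs : SearchRevealed h s)
    (f : Feedback n) : SearchRevealed (h ++ [f]) s :=
  ⟨fun e he => (hs.forest e he).concat f, fun b hb => (hs.best b hb).concat f⟩

/-- The edge `best` enters the forest on silence, without being heard again, so its earlier
announcement has to be remembered. -/
theorem SearchRevealed.next {h : History n} {s : Search n} (hs : SearchRevealed h s)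
    (f : Feedback n) : SearchRevealed (h ++ [f]) (s.next f) := by
  have hs' := hs.concat f
  obtain ⟨F, ph, k⟩ := s
  obtain ⟨h1, h2⟩ := hs'
  match f with
  | .silence =>
    by_cases hk : k = 0
    · match ph with
      | .search none => simpa [Search.next, Search.nextPhase, hk] using ⟨h1, by simp⟩
      | .search (some b) =>
        have : SearchRevealed (h ++ [.silence]) ⟨insert b.1 F, .collect b.2, k⟩ := by
          refine ⟨fun e he => ?_, by simp⟩
          rcases Finset.mem_insert.mp he with rfl | he
          exacts [h2 b rfl, h1 e he]
        simpa [Search.next, Search.nextPhase, hk] using this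
      | .collect x => simpa [Search.next, Search.nextPhase, hk] using ⟨h1, by simp⟩
      | .finished => simpa [Search.next, Search.nextPhase, hk] using ⟨h1, by simp⟩
    · simpa [Search.next, hk] using ⟨h1, h2⟩
  | .collision => exact ⟨h1, h2⟩
  | .heard (.edgeAndWeight e x) =>
    have he := reveals_concat_heard h e x
    match ph with
    | .search b =>
      refine ⟨h1, fun b' hb' => ?_⟩
      obtain rfl : (e, x) = b' := by simpa [Search.next, Search.hear] using hb'
      exact he
    | .collect x =>
      refine ⟨fun e' he' => ?_, by simp [Search.next, Search.hear]⟩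
      rcases Finset.mem_insert.mp he' with rfl | he'
      exacts [he, h1 e' he']
    | .finished => exact ⟨h1, h2⟩
  | .heard .dummy => exact ⟨h1, h2⟩
  | .heard (.weight x) => exact ⟨h1, h2⟩
  | .heard (.edge e) => exact ⟨h1, h2⟩

/-- The invariant of the scan. -/
structure ScanInvariant (inp : Input n m) (h : History n) (s : Scan n) : Prop where
  count_le : s.count ≤ m
  edge_mem : ∀ i : Fin m, (i : ℕ) < s.count → inp.edge i ∈ s.known
  known : ∀ e ∈ s.known, e ∈ inp.graph.edgeSet ∧ s.weight e = inp.weight e ∧ h.Reveals e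
  finished : s.finished = true → s.count = m

theorem ScanInvariant.concat {h : History n} {s : Scan n} (hs : ScanInvariant inp h s)
    (f : Feedback n) : ScanInvariant inp (h ++ [f]) s :=
  ⟨hs.count_le, hs.edge_mem,
    fun e he => ⟨(hs.known e he).1, (hs.known e he).2.1, (hs.known e he).2.2.concat f⟩,
    hs.finished⟩

theorem specified_scan_of_lt {s : Scan n} (h : s.count < m) :
    inp.specified s.query = {⟨s.count, h⟩} := by
  ext i
  rw [inp.mem_specified, Finset.mem_singleton, Fin.ext_iff]
  simp [Scan.query]

theorem specified_scan_of_eq {s : Scan n} (h : s.count = m) :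
    inp.specified s.query = ∅ := by
  ext i
  have := i.2
  rw [inp.mem_specified]
  simp only [Scan.query, Finset.notMem_empty, iff_false]
  omega

theorem ScanInvariant.next {h : History n} {s : Scan n} (hs : ScanInvariant inp h s)
    (hf : s.finished = false) :
    ScanInvariant inp (h ++ [inp.feedback .edgeAndWeight (inp.specified s.query)])
      (s.next (inp.feedback .edgeAndWeight (inp.specified s.query))) ∧
    ((s.next (inp.feedback .edgeAndWeight (inp.specified s.query))).finished = true ∨
      (s.next (inp.feedback .edgeAndWeight (inp.specified s.query))).count = s.count + 1) := by
  rcases hs.count_le.lt_or_eq with hlt | heq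
  · rw [specified_scan_of_lt hlt, inp.feedback_singleton]
    refine ⟨⟨hlt, fun i hi => ?_, fun e he => ?_, fun h => ?_⟩, .inr rfl⟩
    · rcases Nat.lt_succ_iff_lt_or_eq.mp hi with hi | hi
      · exact Finset.mem_insert_of_mem (hs.edge_mem i hi)
      · obtain rfl : i = ⟨s.count, hlt⟩ := Fin.ext hi
        exact Finset.mem_insert_self _ _
    · by_cases hee : e = inp.edge ⟨s.count, hlt⟩
      · subst hee
        exact ⟨inp.edge_mem _, by simp [Scan.next, Content.message],
          reveals_concat_heard h _ _⟩
      · have he' : e ∈ s.known := (Finset.mem_insert.mp he).resolve_left hee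
        obtain ⟨h1, h2, h3⟩ := hs.known e he'
        exact ⟨h1, by simpa [Scan.next, Content.message, hee] using h2, h3.concat _⟩
    · rw [show s.finished = true from h] at hf
      cases hf
  · rw [specified_scan_of_eq heq, inp.feedback_empty]
    obtain ⟨h1, h2, h3, -⟩ := hs.concat (.silence : Feedback n)
    exact ⟨⟨h1, h2, h3, fun _ => heq⟩, .inl rfl⟩

/-- The invariant of the algorithm. -/
structure Invariant (inp : Input n m) (h : History n) : Prop where
  scan : ScanInvariant inp h (stateAfter h).scan
  search : SearchInvariant inp (stateAfter h).search
  revealed : SearchRevealed h (stateAfter h).search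

theorem invariant_nil : Invariant inp [] where
  scan := ⟨Nat.zero_le _, fun _ h => absurd h (Nat.not_lt_zero _), by
    simp [stateAfter, State.init], by simp [stateAfter, State.init]⟩
  search := ⟨isGreedyForest_empty, fun _ _ _ f hf => absurd hf (Finset.notMem_empty f),
    fun _ hb => by cases hb⟩
  revealed := ⟨by simp [stateAfter, State.init], by simp [stateAfter, State.init]⟩

theorem step_of_halted {h : History n} (hh : (stateAfter h).Halted) :
    forestAlgorithm.step inp h = PMF.pure h := by
  simp [Algorithm.step, forestAlgorithm, State.query, hh]

theorem step_of_scanTurn {h : History n} (hh : ¬ (stateAfter h).Halted)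
    (ht : (stateAfter h).scanTurn = true) :
    forestAlgorithm.step inp h = PMF.pure
      (h ++ [inp.feedback .edgeAndWeight (inp.specified (stateAfter h).scan.query)]) := by
  have hq : forestAlgorithm.query n h = some (stateAfter h).scan.query := by
    simp [forestAlgorithm, State.query, hh, ht]
  simp only [Algorithm.step, hq]
  exact (congrArg _ (randomSubset_one _)).trans (PMF.pure_map _ _)

theorem step_of_not_scanTurn {h : History n} (hh : ¬ (stateAfter h).Halted)
    (ht : (stateAfter h).scanTurn = false) :
    forestAlgorithm.step inp h =
      (randomSubset (inp.active (stateAfter h).search) (stateAfter h).search.query.prob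
        (stateAfter h).search.query.prob_le_one).map
          fun A => h ++ [inp.feedback .edgeAndWeight A] := by
  have hq : forestAlgorithm.query n h = some (stateAfter h).search.query := by
    simp [forestAlgorithm, State.query, hh, ht]
  simp only [Algorithm.step, hq]
  rfl

theorem possibleTransmission_of_mem_support {s : Search n} {A : Finset (Fin m)}
    (hA : A ∈ (randomSubset (inp.active s) s.query.prob s.query.prob_le_one).support) :
    PossibleTransmission inp s A :=
  ⟨subset_of_mem_support_randomSubset hA, fun hk =>
    eq_of_mem_support_randomSubset_one (by simp [Search.query, hk]) hA⟩

theorem Invariant.step {h : History n} (hI : Invariant inp h) {h' : History n}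
    (hh' : h' ∈ (forestAlgorithm.step inp h).support) : Invariant inp h' := by
  by_cases hh : (stateAfter h).Halted
  · rw [step_of_halted hh, PMF.support_pure, Set.mem_singleton_iff] at hh'
    exact hh' ▸ hI
  cases ht : (stateAfter h).scanTurn
  · rw [step_of_not_scanTurn hh ht, PMF.mem_support_map_iff] at hh'
    obtain ⟨A, hA, rfl⟩ := hh'
    have hA' := possibleTransmission_of_mem_support hA
    constructor <;> rw [stateAfter_concat] <;> simp only [State.next, ht]
    · exact hI.scan.concat _
    · exact hI.search.next hA'
    · exact hI.revealed.next _
  · rw [step_of_scanTurn hh ht, PMF.support_pure, Set.mem_singleton_iff] at hh'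
    subst hh'
    have hf : (stateAfter h).scan.finished = false := by
      rw [← Bool.not_eq_true]
      exact fun hf => hh (.inl hf)
    constructor <;> rw [stateAfter_concat] <;> simp only [State.next, ht]
    · exact (hI.scan.next hf).1
    · exact hI.search
    · exact hI.revealed.concat _

theorem forestAlgorithm_finds : forestAlgorithm.FindsMinWeightSpanningForest inp := by
  intro t h hh hr
  have hI := invariant_historyAt forestAlgorithm inp (I := fun _ => Invariant inp) invariant_nil
    (fun _ h hI h' => hI.step) t h hh
  rw [forestAlgorithm_running_iff, not_not] at hr
  change IsMinWeightSpanningForest _ _ (stateAfter h).output ∧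
    ∀ e ∈ (stateAfter h).output, h.Reveals e
  by_cases hf : (stateAfter h).scan.finished = true
  · have hall : ((stateAfter h).scan.known : Set (Sym2 (Fin n))) = inp.graph.edgeSet := by
      ext e
      refine ⟨fun he => (hI.scan.known e he).1, fun he => ?_⟩
      obtain ⟨i, rfl⟩ := inp.exists_edge_eq he
      exact hI.scan.edge_mem i (by rw [hI.scan.finished hf]; exact i.2)
    have hspec := (exists_isMinWeightSpanningForest (SimpleGraph.fromEdgeSet
      ((stateAfter h).scan.known : Set (Sym2 (Fin n)))) (stateAfter h).scan.weight).choose_spec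
    rw [State.output, if_pos hf]
    -- The chosen forest depends on the known edges; it is made opaque so that the graph can be
    -- rewritten.
    generalize Exists.choose _ = F at hspec
    rw [hall, SimpleGraph.fromEdgeSet_edgeSet] at hspec
    have hknown : ∀ e ∈ inp.graph.edgeSet, e ∈ (stateAfter h).scan.known := by
      intro e he
      rw [← hall] at he
      exact he
    exact ⟨hspec.congr_weight fun e he => (hI.scan.known e (hknown e he)).2.1,
      fun e he => (hI.scan.known e (hknown e (hspec.1.1 e he))).2.2⟩
  · have hp := hr.resolve_left hf
    rw [State.output, if_neg hf]
    have h2 := hI.search.phase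
    rw [hp] at h2
    exact ⟨hI.search.greedy.isMinWeightSpanningForest h2, hI.revealed.forest⟩

/-- Until halting, every second step advances the scan, so `2 * count` is `t` or `t + 1`, while
`count ≤ m`. For `m ≥ 1`, `t = 4 * m` is impossible. -/
theorem forestAlgorithm_haltsWithin (hm : 1 ≤ m) : forestAlgorithm.HaltsWithin inp (4 * m) := by
  intro h hh
  have hI := invariant_historyAt forestAlgorithm inp
    (I := fun t h => Invariant inp h ∧ ((stateAfter h).Halted ∨
      2 * (stateAfter h).scan.count = t + if (stateAfter h).scanTurn then 0 else 1))
    ⟨invariant_nil, .inr (by simp [stateAfter, State.init])⟩ (by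
      rintro t h ⟨hI, hc⟩ h' hh'
      refine ⟨hI.step hh', ?_⟩
      by_cases hh : (stateAfter h).Halted
      · rw [step_of_halted hh, PMF.support_pure, Set.mem_singleton_iff] at hh'
        exact .inl (hh' ▸ hh)
      have hc := hc.resolve_left hh
      cases ht : (stateAfter h).scanTurn
      · rw [step_of_not_scanTurn hh ht, PMF.mem_support_map_iff] at hh'
        obtain ⟨A, hA, rfl⟩ := hh'
        rw [stateAfter_concat]
        simp only [ht] at hc
        right
        simpa [State.next, ht] using hc
      · rw [step_of_scanTurn hh ht, PMF.support_pure, Set.mem_singleton_iff] at hh'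
        subst hh'
        have hf : (stateAfter h).scan.finished = false := by
          rw [← Bool.not_eq_true]
          exact fun hf => hh (.inl hf)
        rw [stateAfter_concat]
        simp only [ht] at hc
        rcases (hI.scan.next hf).2 with h1 | h1
        · left; left
          simpa [State.next, ht] using h1
        · right
          simp only [State.next, ht, if_true, h1]
          simp at hc ⊢
          omega) _ h hh
  rw [forestAlgorithm_running_iff, not_not]
  refine hI.2.resolve_right fun h2 => ?_
  have := hI.1.scan.count_le
  split_ifs at h2 <;> omega

end Invariants

end Channel

namespace Channel

/-! ### The expected running time -/

section Potential

variable {n m : ℕ} {inp : Input n m} {T : Finset (Sym2 (Fin n))}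

/-- The number of weights of edges in `T` that do not occur in `F`, weighted with the cost of
finding the next weight. -/
noncomputable def weightCost (inp : Input n m) (T F : Finset (Sym2 (Fin n))) : ℕ :=
  (3080 * Nat.size m + 2) * (T.image inp.weight \ F.image inp.weight).card

/-- The potential of a state of the search. -/
noncomputable def potential (inp : Input n m) (T : Finset (Sym2 (Fin n))) (s : Search n) : ℕ :=
  match s.phase with
  | .search _ => 1536 * (T.card - s.forest.card) + guessCost (inp.active s).card s.guess +
      3072 * Nat.size (inp.active s).card + weightCost inp T s.forest + 1
  | .collect _ => 1536 * (T.card - s.forest.card) + guessCost (inp.active s).card s.guess +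
      3076 * Nat.size m + weightCost inp T s.forest + 2
  | .finished => 0

/-- The potential apart from the cost of guessing the probability. -/
noncomputable def restPotential (inp : Input n m) (T : Finset (Sym2 (Fin n))) (s : Search n) : ℕ :=
  match s.phase with
  | .search _ => 1536 * (T.card - s.forest.card) +
      3072 * Nat.size (inp.active s).card + weightCost inp T s.forest + 1
  | .collect _ => 1536 * (T.card - s.forest.card) +
      3076 * Nat.size m + weightCost inp T s.forest + 2
  | .finished => 0

theorem potential_eq {s : Search n} (hs : s.phase ≠ .finished) :
    potential inp T s = guessCost (inp.active s).card s.guess + restPotential inp T s := by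
  unfold potential restPotential
  split <;> first | omega | exact (hs ‹_›).elim

theorem weightCost_anti {F F' : Finset (Sym2 (Fin n))} (h : F ⊆ F') :
    weightCost inp T F' ≤ weightCost inp T F := by
  unfold weightCost
  gcongr

theorem guessCost_zero_le (inp : Input n m) (s : Search n) :
    guessCost (inp.active s).card 0 ≤ 4 * Nat.size m := by
  have := Nat.size_le_size (inp.card_active_le s)
  unfold guessCost
  omega

theorem active_guess_eq (F : Finset (Sym2 (Fin n))) (ph : Phase n) (k k' : ℕ) :
    inp.active ⟨F, ph, k⟩ = inp.active ⟨F, ph, k'⟩ := by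
  ext i
  simp [inp.mem_active]

/-- Restarting the guess costs at most `4 * Nat.size m`. Hence 3076 = 3072 + 4 pays for going from
collecting to searching, and 3080 = 3076 + 4 for going from searching to collecting. -/
theorem potential_nextPhase (hT : IsMinWeightSpanningForest inp.graph inp.weight T)
    {s : Search n} (hs : SearchInvariant inp s) (hf : s.phase ≠ .finished) (hk : s.guess = 0)
    (h0 : inp.active s = ∅) : potential inp T s.nextPhase + 1 ≤ potential inp T s := by
  have hnext := hs.nextPhase h0
  have hsize := Nat.size_le_size (inp.card_active_le s.nextPhase)
  have hguess := guessCost_zero_le inp s.nextPhase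
  have hphase := hs.phase
  obtain ⟨F, ph, k⟩ := s
  obtain rfl : k = 0 := hk
  match ph with
  | .search none => simp [potential, Search.nextPhase]
  | .search (some b) =>
    obtain ⟨hp1, hp2⟩ := hphase
    obtain ⟨hb1, hb2, hb3⟩ := hp2 b rfl
    have hsub := hnext.greedy.image_subset hT
    -- The new weight occurs in `T` but not in `F`, whose edges are all strictly lighter, so one
    -- unused weight of `T` is consumed.
    have hcost : weightCost inp T (insert b.1 F) + (3080 * Nat.size m + 2) ≤
        weightCost inp T F := by
      unfold weightCost
      rw [← Nat.mul_succ]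
      gcongr
      rw [Nat.succ_le_iff]
      apply Finset.card_lt_card
      rw [Finset.ssubset_iff_of_subset (Finset.sdiff_subset_sdiff subset_rfl
        (Finset.image_subset_image (Finset.subset_insert _ _)))]
      refine ⟨inp.weight b.1, Finset.mem_sdiff.mpr ⟨hsub (Finset.mem_image_of_mem _
        (Finset.mem_insert_self _ _)), fun h => ?_⟩, fun h => (Finset.mem_sdiff.mp h).2
          (Finset.mem_image_of_mem _ (Finset.mem_insert_self _ _))⟩
      obtain ⟨f, hf, hfw⟩ := Finset.mem_image.mp h
      exact (hp1 b.1 hb1 hb2 f hf).ne hfw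
    have hcard : F.card ≤ (insert b.1 F).card := Finset.card_le_card (Finset.subset_insert _ _)
    simp only [potential, Search.nextPhase] at hguess ⊢
    omega
  | .collect x =>
    simp only [potential, Search.nextPhase] at hguess hsize ⊢
    omega
  | .finished => exact (hf rfl).elim

theorem active_hear_subset {s : Search n} {i : Fin m} (hi : i ∈ inp.active s) :
    inp.active (s.hear (inp.edge i) (inp.weight (inp.edge i))) ⊆ inp.active s := by
  intro j hj
  rw [inp.mem_active] at hi hj ⊢
  obtain ⟨F, ph, k⟩ := s
  match ph with
  | .search none => exact ⟨hj.1, trivial⟩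
  | .search (some b) => exact ⟨hj.1, lt_trans hj.2 hi.2⟩
  | .collect x =>
    exact ⟨fun h => hj.1 (h.mono (Finset.coe_subset.mpr (Finset.subset_insert _ _))), hj.2⟩
  | .finished => exact hj

theorem active_hear_search {F : Finset (Sym2 (Fin n))} {b : Option (Sym2 (Fin n) × ℝ)} {k : ℕ}
    {i : Fin m} (hi : i ∈ inp.active ⟨F, .search b, k⟩) :
    inp.active (Search.hear ⟨F, .search b, k⟩ (inp.edge i) (inp.weight (inp.edge i))) =
      (inp.active ⟨F, .search b, k⟩).filter
        fun j => inp.weight (inp.edge j) < inp.weight (inp.edge i) := by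
  ext j
  rw [Finset.mem_filter]
  refine ⟨fun hj => ⟨active_hear_subset hi hj, (inp.mem_active.mp hj).2⟩, fun hj => ?_⟩
  exact inp.mem_active.mpr ⟨(inp.mem_active.mp hj.1).1, hj.2⟩

/-- A successful transmission decreases the potential considerably in expectation. -/
theorem sum_restPotential_hear_le (hT : IsMinWeightSpanningForest inp.graph inp.weight T)
    {s : Search n} (hs : SearchInvariant inp s) (hf : s.phase ≠ .finished) :
    ∑ i ∈ inp.active s, restPotential inp T (s.hear (inp.edge i) (inp.weight (inp.edge i))) +
      (inp.active s).card * 1536 ≤ (inp.active s).card * restPotential inp T s := by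
  have hhear := fun i hi => hs.hear (i := i) hi
  obtain ⟨F, ph, k⟩ := s
  match ph with
  | .search b =>
    -- A sole transmitter is equally likely to be any participant; the average loss of half a bit,
    -- times 3072, gives 1536.
    have hsum := two_mul_sum_size_add_card_le (inp.active ⟨F, .search b, k⟩)
      fun i => inp.weight (inp.edge i)
    obtain ⟨c, hc⟩ : ∃ c, c = 1536 * (T.card - F.card) + weightCost inp T F + 1 := ⟨_, rfl⟩
    have h1 : ∀ i ∈ inp.active ⟨F, .search b, k⟩, restPotential inp T
        (Search.hear ⟨F, .search b, k⟩ (inp.edge i) (inp.weight (inp.edge i))) =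
        c + 3072 * Nat.size ((inp.active ⟨F, .search b, k⟩).filter
          fun j => inp.weight (inp.edge j) < inp.weight (inp.edge i)).card := by
      intro i hi
      rw [← active_hear_search hi]
      simp only [restPotential, Search.hear]
      omega
    have h2 : restPotential inp T ⟨F, .search b, k⟩ =
        c + 3072 * Nat.size (inp.active ⟨F, .search b, k⟩).card := by
      simp only [restPotential]
      omega
    rw [Finset.sum_congr rfl h1, Finset.sum_add_distrib, Finset.sum_const, smul_eq_mul,
      ← Finset.mul_sum, h2, mul_add]
    linarith
  | .collect x =>
    rw [← smul_eq_mul, ← Finset.sum_const, ← Finset.sum_add_distrib, ← smul_eq_mul,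
      ← Finset.sum_const]
    refine Finset.sum_le_sum fun i hi => ?_
    -- The enlarged forest still has at most `T.card` edges, so the truncated difference really
    -- drops by one.
    have h1 := (hhear i hi).greedy.card_le hT.1
    have h2 := (inp.mem_active.mp hi).1
    have h3 : inp.edge i ∉ F := fun h => h2 (edgeJoined_of_mem h)
    have h4 := weightCost_anti (inp := inp) (T := T) (Finset.subset_insert (inp.edge i) F)
    simp only [restPotential, Search.hear] at h1 ⊢
    rw [Finset.card_insert_of_notMem h3] at h1 ⊢
    omega
  | .finished => exact (hf rfl).elim

/-- A success keeps the guess and only removes participants, so the guessing cost does not rise. -/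
theorem potential_hear_le {s : Search n} (hf : s.phase ≠ .finished) {i : Fin m}
    (hi : i ∈ inp.active s) :
    potential inp T (s.hear (inp.edge i) (inp.weight (inp.edge i))) ≤
      guessCost (inp.active s).card s.guess +
        restPotential inp T (s.hear (inp.edge i) (inp.weight (inp.edge i))) := by
  have h1 := Finset.card_le_card (active_hear_subset hi)
  have h2 := guessCost_mono h1 s.guess
  have hf' : (s.hear (inp.edge i) (inp.weight (inp.edge i))).phase ≠ .finished ∧
      (s.hear (inp.edge i) (inp.weight (inp.edge i))).guess = s.guess := by
    obtain ⟨F, ph, k⟩ := s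
    match ph with
    | .search b => simp [Search.hear]
    | .collect x => simp [Search.hear]
    | .finished => exact (hf rfl).elim
  rw [potential_eq hf'.1, hf'.2]
  omega

theorem restPotential_guess (F : Finset (Sym2 (Fin n))) (ph : Phase n) (k k' : ℕ) :
    restPotential inp T ⟨F, ph, k⟩ = restPotential inp T ⟨F, ph, k'⟩ := by
  unfold restPotential
  simp only [active_guess_eq F ph k k']

/-- Each step of the search decreases the potential by at least one in expectation. -/
theorem potential_drift (hT : IsMinWeightSpanningForest inp.graph inp.weight T)
    {s : Search n} (hs : SearchInvariant inp s) (hf : s.phase ≠ .finished) :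
    ∑' A, randomSubset (inp.active s) s.query.prob s.query.prob_le_one A *
      (potential inp T (s.next (inp.feedback .edgeAndWeight A)) : ℝ≥0∞) + 1 ≤
        potential inp T s := by
  set g : Finset (Fin m) → ℕ :=
    fun A => potential inp T (s.next (inp.feedback .edgeAndWeight A)) with hg
  set S := inp.active s with hS
  have hp : (s.query.prob : ℝ) = (2 ^ s.guess)⁻¹ := by simp [Search.query]
  rw [tsum_randomSubset_mul g, sum_powerset_eq_of_card_two_le _
    (potential inp T { s with guess := s.guess + 1 } : ℝ) _ (by
      intro A hA
      simp only [hg, inp.feedback_of_two_le _ hA]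
      rfl), hp]
  have hV := potential_eq (inp := inp) (T := T) hf
  suffices h : (1 - (2 ^ s.guess)⁻¹) ^ S.card * (g ∅ : ℝ) +
      (2 ^ s.guess)⁻¹ * (1 - (2 ^ s.guess)⁻¹) ^ (S.card - 1) * ∑ i ∈ S, (g {i} : ℝ) +
      (1 - (1 - (2 ^ s.guess)⁻¹) ^ S.card -
        S.card * ((2 ^ s.guess)⁻¹ * (1 - (2 ^ s.guess)⁻¹) ^ (S.card - 1))) *
          (potential inp T { s with guess := s.guess + 1 } : ℝ) ≤ (potential inp T s : ℝ) - 1 by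
    have hpos : 1 ≤ potential inp T s := by
      unfold potential
      split <;> first | omega | exact (hf ‹_›).elim
    calc _ ≤ ENNReal.ofReal ((potential inp T s : ℝ) - 1) + 1 := by
          gcongr
      _ = potential inp T s := by
          rw [← ENNReal.ofReal_one, ← ENNReal.ofReal_add (by
            have : (1 : ℝ) ≤ potential inp T s := by exact_mod_cast hpos
            linarith) (by norm_num)]
          simp
  -- In the excluded case silence is certain and the phase changes; otherwise `guess_drift` applies,
  -- with the gain on success averaged over the participants.
  by_cases hsk : 1 ≤ S.card ∨ 1 ≤ s.guess
  · have hc : potential inp T { s with guess := s.guess + 1 } =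
        guessCost S.card (s.guess + 1) + restPotential inp T s := by
      rw [potential_eq (by exact hf), hS]
      obtain ⟨F, ph, k⟩ := s
      simp only [active_guess_eq F ph (k + 1) k, restPotential_guess F ph (k + 1) k]
    have h0 : 1 ≤ s.guess → g ∅ = guessCost S.card (s.guess - 1) + restPotential inp T s := by
      intro hk
      have : s.next (inp.feedback .edgeAndWeight ∅) = { s with guess := s.guess - 1 } := by
        rw [inp.feedback_empty]
        simp [Search.next, show s.guess ≠ 0 by omega]
      simp only [hg, this]
      rw [potential_eq (by exact hf), hS]
      obtain ⟨F, ph, k⟩ := s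
      simp only [active_guess_eq F ph (k - 1) k, restPotential_guess F ph (k - 1) k]
    have h1 : ∑ i ∈ S, g {i} + S.card * 1536 ≤ S.card * potential inp T s := by
      have h2 : ∑ i ∈ S, g {i} ≤ ∑ i ∈ S, (guessCost S.card s.guess +
          restPotential inp T (s.hear (inp.edge i) (inp.weight (inp.edge i)))) := by
        refine Finset.sum_le_sum fun i hi => ?_
        simp only [hg, inp.feedback_singleton]
        exact potential_hear_le hf hi
      rw [Finset.sum_add_distrib, Finset.sum_const, smul_eq_mul] at h2
      have h3 := sum_restPotential_hear_le hT hs hf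
      rw [← hS] at h3 hV
      rw [hV, mul_add]
      omega
    have h1' : ∑ i ∈ S, (g {i} : ℝ) + S.card * 1536 ≤ S.card * (potential inp T s : ℝ) := by
      exact_mod_cast h1
    have key := guess_drift (s := S.card) (k := s.guess)
      (v₀ := (g ∅ : ℝ) - potential inp T s) (v₁ := -1536)
      (v₂ := (potential inp T { s with guess := s.guess + 1 } : ℝ) - potential inp T s) hsk
      (fun hk => by rw [h0 hk, hV]; push_cast; linarith) le_rfl
      (by rw [hc, hV]; push_cast; linarith)
    have hq : (0 : ℝ) ≤ (2 ^ s.guess)⁻¹ * (1 - (2 ^ s.guess)⁻¹) ^ (S.card - 1) := by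
      have : ((2 : ℝ) ^ s.guess)⁻¹ ≤ 1 := inv_le_one_of_one_le₀ (one_le_pow₀ (by norm_num))
      have : (0 : ℝ) ≤ 1 - (2 ^ s.guess)⁻¹ := by linarith
      positivity
    have := mul_le_mul_of_nonneg_left h1' hq
    linarith
  · have hS0 : S = ∅ := Finset.card_eq_zero.mp (by omega)
    have hk : s.guess = 0 := by omega
    have h0 := potential_nextPhase hT hs hf hk hS0
    have hg0 : g ∅ = potential inp T s.nextPhase := by
      simp only [hg, inp.feedback_empty]
      simp [Search.next, hk]
    have h0' : (potential inp T s.nextPhase : ℝ) + 1 ≤ potential inp T s := by exact_mod_cast h0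
    rw [hS0]
    simp only [Finset.card_empty, pow_zero, Finset.sum_empty, hg0]
    push_cast
    linarith

/-- Doubling the potential and adding 1 at scan turns makes both kinds of step gain one: a search
step gains 2 and returns 1, a scan step spends that 1. -/
theorem forestAlgorithm_expectedTime_le
    (hT : IsMinWeightSpanningForest inp.graph inp.weight T) :
    forestAlgorithm.expectedTime inp ≤
      ((2 * potential inp T ⟨∅, .search none, 0⟩ + 1 : ℕ) : ℝ≥0∞) := by
  refine (expectedTime_le_of_drift forestAlgorithm inp (I := Invariant inp)
    (fun h => 2 * (potential inp T (stateAfter h).search : ℝ≥0∞) +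
      if (stateAfter h).scanTurn then 1 else 0) invariant_nil
    (fun h hI h' => hI.step) fun h hI hr => ?_).trans ?_
  · rw [forestAlgorithm_running_iff] at hr
    cases ht : (stateAfter h).scanTurn
    · rw [step_of_not_scanTurn hr ht, PMF.tsum_map_mul]
      have hd := potential_drift hT hI.search fun h => hr (.inr h)
      simp only [stateAfter_concat, State.next, ht, mul_add, ENNReal.tsum_add]
      simp only [Bool.false_eq_true, if_false, if_true, mul_one, PMF.tsum_coe, add_zero]
      simp_rw [mul_left_comm _ (2 : ℝ≥0∞)]
      rw [ENNReal.tsum_mul_left]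
      calc _ = 2 * (∑' A, randomSubset (inp.active (stateAfter h).search)
              (stateAfter h).search.query.prob (stateAfter h).search.query.prob_le_one A *
              (potential inp T ((stateAfter h).search.next
                (inp.feedback .edgeAndWeight A)) : ℝ≥0∞) + 1) := by
            rw [mul_add, add_assoc, one_add_one_eq_two, mul_one]
        _ ≤ _ := by gcongr
    · rw [step_of_scanTurn hr ht, PMF.tsum_pure_mul]
      simp [stateAfter_concat, State.next, ht]
  · simp [stateAfter, State.init]

theorem size_le_log {m : ℕ} (hm : 1 ≤ m) : (Nat.size m : ℝ) ≤ 1 + 2 * Real.log m := by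
  have h1 : 2 ^ (Nat.size m - 1) ≤ m := Nat.lt_size.mp (by
    have := Nat.size_pos.mpr hm
    omega)
  have h2 : (2 : ℝ) ^ (Nat.size m - 1) ≤ m := by exact_mod_cast h1
  have h3 := Real.log_le_log (by positivity) h2
  rw [Real.log_pow] at h3
  have h4 := Real.log_two_gt_d9
  have h5 : (Nat.size m : ℝ) ≤ (Nat.size m - 1 : ℕ) + 1 := by
    have : Nat.size m ≤ Nat.size m - 1 + 1 := by omega
    exact_mod_cast this
  have h6 : (0 : ℝ) ≤ (Nat.size m - 1 : ℕ) := by positivity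
  nlinarith

/-- As `m ≥ 1`, the forest has an edge, so 1 ≤ W ≤ |T|. This absorbs the start-up cost of order log
m into W log m, and the additive constants into |T|. -/
theorem potential_init_le (hm : 1 ≤ m) (hT : IsMinWeightSpanningForest inp.graph inp.weight T) :
    (((2 * potential inp T ⟨∅, .search none, 0⟩ + 1 : ℕ)) : ℝ) ≤
      40000 * ((T.card : ℝ) + (numWeights inp.weight T : ℝ) * Real.log m) := by
  have hS := Nat.size_le_size (inp.card_active_le ⟨∅, .search none, 0⟩)
  have hG := guessCost_zero_le inp ⟨∅, .search none, 0⟩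
  have hW : numWeights inp.weight T ≤ T.card := Finset.card_image_le
  have hW1 : 1 ≤ numWeights inp.weight T := by
    rw [numWeights, Nat.one_le_iff_ne_zero, Ne, Finset.card_eq_zero, Finset.image_eq_empty]
    rintro rfl
    have hj := hT.1.edgeJoined (inp.edge_mem ⟨0, hm⟩)
    have hd := inp.graph.not_isDiag_of_mem_edgeSet (inp.edge_mem ⟨0, hm⟩)
    generalize inp.edge ⟨0, hm⟩ = e at hj hd
    induction e with | _ u v => ?_
    rw [edgeJoined_mk] at hj
    exact hd (by simpa using hj)
  have hpot : potential inp T ⟨∅, .search none, 0⟩ ≤ 1536 * T.card + 3076 * Nat.size m +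
      (3080 * Nat.size m + 2) * numWeights inp.weight T + 1 := by
    simp only [potential, weightCost, Finset.image_empty, Finset.sdiff_empty, Finset.card_empty]
    rw [numWeights]
    omega
  have hpot' : (potential inp T ⟨∅, .search none, 0⟩ : ℝ) ≤ 1536 * T.card + 3076 * Nat.size m +
      (3080 * Nat.size m + 2) * numWeights inp.weight T + 1 := by exact_mod_cast hpot
  have hW' : (numWeights inp.weight T : ℝ) ≤ T.card := by exact_mod_cast hW
  have hW1' : (1 : ℝ) ≤ numWeights inp.weight T := by exact_mod_cast hW1
  have hlog := size_le_log hm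
  have hlog0 : 0 ≤ Real.log m := Real.log_natCast_nonneg m
  push_cast
  have h1 : (Nat.size m : ℝ) * numWeights inp.weight T ≤
      numWeights inp.weight T + 2 * (numWeights inp.weight T * Real.log m) := by nlinarith
  have h2 : (Nat.size m : ℝ) ≤ Nat.size m * numWeights inp.weight T := by
    have : (0 : ℝ) ≤ Nat.size m := by positivity
    nlinarith
  nlinarith [mul_nonneg (zero_le_one.trans hW1') hlog0]

end Potential

end Channel

theorem mainTheorem4 :
    ∃ (alg : Channel.Algorithm) (C : ℝ) (K : ℕ),
      ∀ (n m : ℕ), 1 ≤ m → ∀ inp : Channel.Input n m,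
        alg.FindsMinWeightSpanningForest inp ∧
        (∀ T : Finset (Sym2 (Fin n)),
          IsMinWeightSpanningForest inp.graph inp.weight T →
          alg.expectedTime inp ≤
            ENNReal.ofReal (C * ((T.card : ℝ) + (numWeights inp.weight T : ℝ) * Real.log m))) ∧
        alg.HaltsWithin inp (K * m) := by
  refine ⟨Channel.forestAlgorithm, 40000, 4, fun n m hm inp =>
    ⟨Channel.forestAlgorithm_finds, fun T hT => ?_, Channel.forestAlgorithm_haltsWithin hm⟩⟩
  refine (Channel.forestAlgorithm_expectedTime_le hT).trans ?_
  rw [← ENNReal.ofReal_natCast]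
  exact ENNReal.ofReal_le_ofReal (Channel.potential_init_le hm hT)
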